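/- Let $\mathbb R_+=(0,\infty)$, $\mathbb R_-=(-\infty,0)$ and $\mathfrak A f(t)=-\tfrac12 f''(t)+\tfrac12 t^2 f(t)$. In the complex Hilbert space $L_2(\mathbb R_\pm)$ let $A_\pm^{\max}f=\mathfrak A f$ be the maximal operator, with domain $$\mathcal D(A_\pm^{\max})=\{f\in L_2(\mathbb R_\pm): f,f' \text{ are absolutely continuous on every compact subinterval of } \mathbb R_\pm,\ \mathfrak A f\in L_2(\mathbb R_\pm)\}.$$ For such $f$ the limits $f(\pm0)$ and $f'(\pm0)$ of $f(t)$ and $f'(t)$, as $t\to0$ with $t\in\mathbb R_\pm$, exist. For $\theta\in[0,\pi)$ let $A_{\pm,\theta}$ be the restriction of $A_\pm^{\max}$ to $$\mathcal D(A_{\pm,\theta})=\{f\in\mathcal D(A_\pm^{\max}): \cos(\theta)f(\pm0)=\sin(\theta)f'(\pm0)\}.$$ Thus $\theta=0$ is the Dirichlet and $\theta=\frac\pi2$ the Neumann condition at $0$. For $n\in\mathbb N_0$ let $H_n(t)=(-1)^n e^{t^2}\frac{d^n}{dt^n}e^{-t^2}$, let $\psi_n(t)=(\sqrt\pi\,2^n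 n!)^{-1/2}e^{-t^2/2}H_n(t)$, and let $\psi_{n,\pm}=\psi_n|_{\mathbb R_\pm}$. Write $\sigma(T)$ for the spectrum of an operator $T$ (the complement in $\mathbb C$ of the set of those $z$ for which $T-z$ is a bijection of $\mathcal D(T)$ onto the whole space with bounded inverse) and $\sigma_p(T)$ for its set of eigenvalues. Then, for each choice of the sign $\pm$: (i) $\sigma(A_{\pm,0})=\sigma_p(A_{\pm,0})=\{2n+\tfrac32:n\in\mathbb N_0\}$, and for each $n\in\mathbb N_0$ one has $\psi_{2n+1,\pm}\in L_2(\mathbb R_\pm)$ and $\ker\bigl(A_{\pm,0}-(2n+\tfrac32)\bigr)=\operatorname{span}\{\psi_{2n+1,\pm}\}$. (ii) $\sigma(A_{\pm,\pi/2})=\sigma_p(A_{\pm,\pi/2})=\{2n+\tfrac12:n\in\mathbb N_0\}$, and for each $n\in\mathbb N_0$ one has $\psi_{2n,\pm}\in L_2(\mathbb R_\pm)$ and $\ker\bigl(A_{\pm,\pi/2}-(2n+\tfrac12)\bigr)=\operatorname{span}\{\psi_{2n,\pm}\}$. -/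

import Mathlib

open MeasureTheory Set Filter Topology

noncomputable section

namespace HalfLineOscillator

/-- The open half line `ℝ₊ = (0, ∞)`. -/
def RPlus : TopologicalSpace.Opens ℝ := ⟨Ioi 0, isOpen_Ioi⟩

/-- The open half line `ℝ₋ = (-∞, 0)`. -/
def RMinus : TopologicalSpace.Opens ℝ := ⟨Iio 0, isOpen_Iio⟩

/-- The complex Hilbert space `L₂(S)` of an open set `S ⊆ ℝ`, with Lebesgue measure. -/
abbrev L2 (S : TopologicalSpace.Opens ℝ) : Type :=
  Lp ℂ 2 (volume.restrict (S : Set ℝ))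

/-- The harmonic oscillator expression `-(1/2) u'' + (1/2) t² u`. -/
def expr (u : ℝ → ℂ) (t : ℝ) : ℂ :=
  -(1 / 2) * deriv (deriv u) t + (1 / 2) * (t : ℂ) ^ 2 * u t

/-- `u` is (locally) absolutely continuous on `S`: it is absolutely continuous on every compact
interval contained in `S`. -/
def LocAC (S : TopologicalSpace.Opens ℝ) (u : ℝ → ℂ) : Prop :=
  ∀ a b : ℝ, uIcc a b ⊆ (S : Set ℝ) → AbsolutelyContinuousOnInterval u a b

/-- The functions on `S` that form the domain of the maximal operator. Only the values of `u`
on the open set `S` matter. -/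
structure IsMax (S : TopologicalSpace.Opens ℝ) (u : ℝ → ℂ) : Prop where
  ac : LocAC S u
  diff : ∀ t ∈ S, DifferentiableAt ℝ u t
  ac_deriv : LocAC S (deriv u)
  memLp : MemLp u 2 (volume.restrict (S : Set ℝ))
  memLp_expr : MemLp (expr u) 2 (volume.restrict (S : Set ℝ))

section Helpers

variable {S : TopologicalSpace.Opens ℝ} {u v : ℝ → ℂ}

theorem LocAC.ae_diff (h : LocAC S u) :
    ∀ᵐ t ∂(volume.restrict (S : Set ℝ)), DifferentiableAt ℝ u t := by
  rw [ae_restrict_iff' S.isOpen.measurableSet]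
  have key : ∀ p : ℚ × ℚ, ∀ᵐ t : ℝ, uIcc (p.1 : ℝ) p.2 ⊆ (S : Set ℝ) →
      t ∈ Ioo (p.1 : ℝ) p.2 → DifferentiableAt ℝ u t := by
    intro p
    by_cases hp : uIcc (p.1 : ℝ) p.2 ⊆ (S : Set ℝ)
    · have hbv := (h p.1 p.2 hp).boundedVariationOn
      filter_upwards [hbv.locallyBoundedVariationOn.ae_differentiableWithinAt_of_mem]
        with t ht _ hmem
      refine (ht ?_).differentiableAt ?_
      · exact Ioo_subset_Icc_self.trans Icc_subset_uIcc hmem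
      · exact mem_of_superset (isOpen_Ioo.mem_nhds hmem)
          (Ioo_subset_Icc_self.trans Icc_subset_uIcc)
    · exact Eventually.of_forall fun t h' => absurd h' hp
  filter_upwards [ae_all_iff.2 key] with t ht htS
  obtain ⟨ε, hε, hball⟩ := Metric.isOpen_iff.1 S.isOpen t htS
  obtain ⟨p, hp1, hp2⟩ := exists_rat_btwn (show t - ε < t by linarith)
  obtain ⟨q, hq1, hq2⟩ := exists_rat_btwn (show t < t + ε by linarith)
  refine ht (p, q) ?_ ⟨hp2, hq1⟩
  rw [uIcc_of_le (by simpa using (hp2.trans hq1).le)]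
  intro x hx
  apply hball
  rw [Real.ball_eq_Ioo]
  exact ⟨hp1.trans_le hx.1, hx.2.trans_lt hq2⟩

theorem LocAC.congr (h : LocAC S u) (e : EqOn u v S) : LocAC S v := by
  intro a b hab
  refine (tendsto_congr' ?_).1 (h a b hab)
  refine mem_inf_of_right ?_
  intro E hE
  refine Finset.sum_congr rfl fun i hi => ?_
  rw [e (hab (hE.1 i hi).1), e (hab (hE.1 i hi).2)]

theorem IsMax.deriv_add (hu : IsMax S u) (hv : IsMax S v) :
    EqOn (deriv (u + v)) (deriv u + deriv v) S := fun t ht => by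
  simpa using _root_.deriv_add (hu.diff t ht) (hv.diff t ht)

theorem IsMax.expr_add (hu : IsMax S u) (hv : IsMax S v) :
    expr (u + v) =ᵐ[volume.restrict (S : Set ℝ)] expr u + expr v := by
  filter_upwards [hu.ac_deriv.ae_diff, hv.ac_deriv.ae_diff,
    ae_restrict_mem S.isOpen.measurableSet] with t h1 h2 ht
  have e : deriv (deriv (u + v)) t = deriv (deriv u) t + deriv (deriv v) t := by
    rw [(hu.deriv_add hv).deriv S.isOpen ht]
    exact _root_.deriv_add h1 h2
  simp only [expr, e, Pi.add_apply]
  ring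

theorem IsMax.add (hu : IsMax S u) (hv : IsMax S v) : IsMax S (u + v) where
  ac a b h := (hu.ac a b h).add (hv.ac a b h)
  diff t ht := (hu.diff t ht).add (hv.diff t ht)
  ac_deriv := by
    have : LocAC S (deriv u + deriv v) :=
      fun a b h => (hu.ac_deriv a b h).add (hv.ac_deriv a b h)
    exact this.congr (hu.deriv_add hv).symm
  memLp := hu.memLp.add hv.memLp
  memLp_expr := (memLp_congr_ae (hu.expr_add hv)).2 (hu.memLp_expr.add hv.memLp_expr)

theorem deriv_smul_eq (c : ℂ) (u : ℝ → ℂ) : deriv (c • u) = c • deriv u := by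
  funext t
  exact deriv_const_smul_field c u

theorem expr_smul (c : ℂ) (u : ℝ → ℂ) : expr (c • u) = c • expr u := by
  funext t
  simp only [expr, deriv_smul_eq, Pi.smul_apply, smul_eq_mul]
  ring

theorem IsMax.smul (c : ℂ) (hu : IsMax S u) : IsMax S (c • u) where
  ac a b h := (hu.ac a b h).const_smul c
  diff t ht := (hu.diff t ht).const_smul c
  ac_deriv := by
    rw [deriv_smul_eq]
    exact fun a b h => (hu.ac_deriv a b h).const_smul c
  memLp := hu.memLp.const_smul c
  memLp_expr := by
    rw [expr_smul]
    exact hu.memLp_expr.const_smul c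

theorem isMax_zero : IsMax S 0 := by
  have h0 : LocAC S 0 := fun a b _ => by
    simpa [AbsolutelyContinuousOnInterval] using tendsto_const_nhds
  have hd : deriv (0 : ℝ → ℂ) = 0 := by funext t; exact deriv_const t 0
  have he : expr 0 = 0 := by funext t; simp [expr, hd]
  refine ⟨h0, fun t _ => differentiableAt_const 0, by rwa [hd], MemLp.zero, ?_⟩
  rw [he]
  exact MemLp.zero

theorem IsMax.eqOn (hu : IsMax S u) (hv : IsMax S v)
    (h : u =ᵐ[volume.restrict (S : Set ℝ)] v) : EqOn u v S :=
  Measure.eqOn_open_of_ae_eq h S.isOpen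
    (fun t ht => (hu.diff t ht).continuousAt.continuousWithinAt)
    (fun t ht => (hv.diff t ht).continuousAt.continuousWithinAt)

theorem expr_eqOn (e : EqOn u v S) : EqOn (expr u) (expr v) S := fun t ht => by
  simp only [expr, e ht, (e.deriv S.isOpen).deriv S.isOpen ht]

end Helpers

/-- The domain of the maximal operator, as a subspace of `L₂(S)`. -/
def maxDomain (S : TopologicalSpace.Opens ℝ) : Submodule ℂ (L2 S) where
  carrier := {f | ∃ u : ℝ → ℂ, IsMax S u ∧ f =ᵐ[volume.restrict (S : Set ℝ)] u}
  add_mem' := by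
    rintro f g ⟨u, hu, hfu⟩ ⟨v, hv, hgv⟩
    exact ⟨u + v, hu.add hv, (Lp.coeFn_add f g).trans (hfu.add hgv)⟩
  zero_mem' := ⟨0, isMax_zero, Lp.coeFn_zero _ _ _⟩
  smul_mem' := by
    rintro c f ⟨u, hu, hfu⟩
    exact ⟨c • u, hu.smul c, (Lp.coeFn_smul c f).trans (hfu.const_smul c)⟩

/-- The value of the maximal operator: the class of `expr u`, for `u` the representative of `f`
in the class `IsMax`, whose values on `S` are determined by `f`. -/
def maxFun (S : TopologicalSpace.Opens ℝ) (f : maxDomain S) : L2 S :=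
  MemLp.toLp (expr f.2.choose) f.2.choose_spec.1.memLp_expr

theorem maxFun_eq {S : TopologicalSpace.Opens ℝ} (f : maxDomain S) {u : ℝ → ℂ} (hu : IsMax S u)
    (hfu : (f : L2 S) =ᵐ[volume.restrict (S : Set ℝ)] u) :
    maxFun S f = MemLp.toLp (expr u) hu.memLp_expr := by
  refine MemLp.toLp_congr _ _ ?_
  have h := f.2.choose_spec
  have e := expr_eqOn (h.1.eqOn hu (h.2.symm.trans hfu))
  filter_upwards [ae_restrict_mem S.isOpen.measurableSet] with t ht using e ht

/-- The maximal operator in `L₂(S)` associated with the harmonic oscillator expression. -/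
def maxOp (S : TopologicalSpace.Opens ℝ) : L2 S →ₗ.[ℂ] L2 S where
  domain := maxDomain S
  toFun :=
    { toFun := maxFun S
      map_add' := by
        intro f g
        obtain ⟨u, hu, hfu⟩ := f.2
        obtain ⟨v, hv, hgv⟩ := g.2
        rw [maxFun_eq f hu hfu, maxFun_eq g hv hgv, maxFun_eq (f + g) (hu.add hv)
          ((Lp.coeFn_add (f : L2 S) g).trans (hfu.add hgv)), ← MemLp.toLp_add]
        exact MemLp.toLp_congr _ _ (hu.expr_add hv)
      map_smul' := by
        intro c f
        obtain ⟨u, hu, hfu⟩ := f.2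
        rw [RingHom.id_apply, maxFun_eq f hu hfu, maxFun_eq (c • f) (hu.smul c)
          ((Lp.coeFn_smul c (f : L2 S)).trans (hfu.const_smul c)), ← MemLp.toLp_const_smul]
        exact MemLp.toLp_congr _ _ (by rw [expr_smul]) }

/-- The elements of the maximal domain with `cos θ · f(±0) = sin θ · f'(±0)`, where `f(±0)` and
`f'(±0)` are the limits of `f` and `f'` at `0` from inside `S`. -/
def boundaryCondition (S : TopologicalSpace.Opens ℝ) (θ : ℝ) : Submodule ℂ (L2 S) where
  carrier := {f | ∃ u : ℝ → ℂ, IsMax S u ∧ f =ᵐ[volume.restrict (S : Set ℝ)] u ∧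
    ∃ a b : ℂ, Tendsto u (𝓝[(S : Set ℝ)] 0) (𝓝 a) ∧ Tendsto (deriv u) (𝓝[(S : Set ℝ)] 0) (𝓝 b) ∧
      (Real.cos θ : ℂ) * a = (Real.sin θ : ℂ) * b}
  add_mem' := by
    rintro f g ⟨u, hu, hfu, a, b, ha, hb, hab⟩ ⟨v, hv, hgv, a', b', ha', hb', hab'⟩
    refine ⟨u + v, hu.add hv, (Lp.coeFn_add f g).trans (hfu.add hgv), a + a', b + b',
      ha.add ha', (hb.add hb').congr' ?_, by rw [mul_add, mul_add, hab, hab']⟩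
    filter_upwards [self_mem_nhdsWithin] with t ht using (hu.deriv_add hv ht).symm
  zero_mem' := by
    refine ⟨0, isMax_zero, Lp.coeFn_zero _ _ _, 0, 0, tendsto_const_nhds, ?_, by simp⟩
    have hd : deriv (0 : ℝ → ℂ) = fun _ => 0 := by funext t; exact deriv_const t 0
    rw [hd]
    exact tendsto_const_nhds
  smul_mem' := by
    rintro c f ⟨u, hu, hfu, a, b, ha, hb, hab⟩
    refine ⟨c • u, hu.smul c, (Lp.coeFn_smul c f).trans (hfu.const_smul c), c * a, c * b,
      ha.const_mul c, ?_, by linear_combination c * hab⟩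
    rw [deriv_smul_eq]
    exact hb.const_mul c

/-- The operator `A_{±,θ}` (for `S = RPlus` and `S = RMinus`): the restriction of the maximal
operator by the boundary condition with parameter `θ`. -/
def oscillator (S : TopologicalSpace.Opens ℝ) (θ : ℝ) : L2 S →ₗ.[ℂ] L2 S :=
  (maxOp S).domRestrict (boundaryCondition S θ)

section Spectrum

variable {H : Type*} [NormedAddCommGroup H] [NormedSpace ℂ H]

/-- The resolvent set of an unbounded operator: `T - z` maps its domain bijectively onto the
space, with a bounded everywhere defined inverse `R`. -/
def resolventSet (T : H →ₗ.[ℂ] H) : Set ℂ :=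
  {z | ∃ R : H →L[ℂ] H, (∀ x : T.domain, R (T x - z • (x : H)) = x) ∧
    ∀ y : H, ∃ x : T.domain, (x : H) = R y ∧ T x - z • (x : H) = y}

/-- The spectrum `σ(T)` of an unbounded operator. -/
def spectrum (T : H →ₗ.[ℂ] H) : Set ℂ := (resolventSet T)ᶜ

/-- The eigenspace `ker (T - z)`. -/
def eigenspace (T : H →ₗ.[ℂ] H) (z : ℂ) : Submodule ℂ H :=
  (LinearMap.ker (T.toFun - z • T.domain.subtype)).map T.domain.subtype

/-- The point spectrum `σ_p(T)`: the set of eigenvalues. -/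
def pointSpectrum (T : H →ₗ.[ℂ] H) : Set ℂ := {z | eigenspace T z ≠ ⊥}

end Spectrum

/-- The Hermite polynomial function `Hₙ(t) = (-1)ⁿ exp(t²) dⁿ/dtⁿ exp(-t²)`. -/
def hermiteH (n : ℕ) (t : ℝ) : ℝ :=
  (-1) ^ n * Real.exp (t ^ 2) * iteratedDeriv n (fun s : ℝ => Real.exp (-s ^ 2)) t

/-- The Hermite function `ψₙ(t) = exp(-t²/2) cₙ Hₙ(t)`, with `cₙ = (√π 2ⁿ n!)^(-1/2)`. -/
def hermiteFun (n : ℕ) (t : ℝ) : ℂ :=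
  ((Real.exp (-t ^ 2 / 2) * (√(√Real.pi * 2 ^ n * (n.factorial : ℝ)))⁻¹ * hermiteH n t : ℝ) : ℂ)

end HalfLineOscillator

end

/-! The Hermite functions of one parity diagonalize the operator. Odd ones vanish at 0, even ones
have vanishing derivative there, and `expr_hermiteFun` gives the eigenvalue `n + 1/2`. Three further
facts determine the whole spectrum, with neither a self-adjointness theorem nor a classification of
the solutions of the eigenvalue equation.

Symmetry (`integral_hermiteFun_mul_expr`): Green's identity of a domain element against a Hermite
function has no boundary terms. At 0 the two boundary conditions agree, and at infinity the Gaussian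
beats polynomial growth.

Totality (`eq_zero_of_integral_hermiteFun`): an element of L₂ of the half line, extended to the line
with the parity of the family, is orthogonal to every Hermite function. By the recurrence it then
has vanishing Gaussian moments, so its product with the Gaussian has zero Fourier transform.

Closedness (`oscillator_closed`): a domain element `f` with image `g` has the form `a + b t` plus
the double primitive of `t² f - 2 g`, which depends continuously on `f` and `g`. This formula also
supplies the polynomial growth bound used in Green's identity.

After normalization the eigenvectors form a Hilbert basis. For `z` off the eigenvalues, `T - z` is
inverted by dividing coefficients, and closedness puts the resulting series in the domain
(`spectrum_of_total_eigenfamily`). -/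

noncomputable section

namespace HalfLineOscillator

/-! ### Closed operators with a total family of eigenvectors -/

section AbstractSpectrum

variable {H : Type*} [NormedAddCommGroup H]

theorem mem_eigenspace_iff [NormedSpace ℂ H] {T : H →ₗ.[ℂ] H} {z : ℂ} {y : H} :
    y ∈ eigenspace T z ↔ ∃ x : T.domain, (x : H) = y ∧ T x = z • (x : H) := by
  simp only [eigenspace, Submodule.mem_map, LinearMap.mem_ker, LinearMap.sub_apply,
    LinearMap.smul_apply, Submodule.subtype_apply, sub_eq_zero]
  exact ⟨fun ⟨x, h1, h2⟩ => ⟨x, h2, h1⟩, fun ⟨x, h1, h2⟩ => ⟨x, h2, h1⟩⟩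

theorem pointSpectrum_subset_spectrum [NormedSpace ℂ H] (T : H →ₗ.[ℂ] H) :
    pointSpectrum T ⊆ spectrum T := by
  rintro z hz ⟨R, hR, -⟩
  refine hz ((Submodule.eq_bot_iff _).2 fun y hy => ?_)
  obtain ⟨x, rfl, hx⟩ := mem_eigenspace_iff.1 hy
  simpa [hx] using (hR x).symm

/-- A point `z` is in the resolvent set as soon as `T - z` is onto and bounded below. -/
theorem mem_resolventSet_of_bounded_below [NormedSpace ℂ H] {T : H →ₗ.[ℂ] H} {z : ℂ} {δ : ℝ}
    (hδ : 0 < δ) (hbelow : ∀ x : T.domain, δ * ‖(x : H)‖ ≤ ‖T x - z • (x : H)‖)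
    (hsurj : ∀ y : H, ∃ x : T.domain, T x - z • (x : H) = y) : z ∈ resolventSet T := by
  have hinj : ∀ x x' : T.domain, T x - z • (x : H) = T x' - z • (x' : H) → x = x' := by
    intro x x' h
    have h1 := hbelow (x - x')
    have h2 : T (x - x') - z • ((x - x' : T.domain) : H) = 0 := by
      rw [T.map_sub, Submodule.coe_sub, smul_sub, ← sub_eq_zero.2 h]
      abel
    rw [h2, norm_zero] at h1
    have h3 : ‖((x - x' : T.domain) : H)‖ = 0 := by
      refine le_antisymm ?_ (norm_nonneg _)
      by_contra! h4
      exact absurd h1 (not_le.2 (mul_pos hδ h4))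
    exact sub_eq_zero.1 (Subtype.ext (norm_eq_zero.1 h3))
  choose r hr using hsurj
  let R₀ : H →ₗ[ℂ] H :=
    { toFun := fun y => (r y : H)
      map_add' := fun y y' => by
        rw [← Submodule.coe_add]
        congr 1
        apply hinj
        rw [hr, T.map_add, Submodule.coe_add, smul_add, add_sub_add_comm, hr, hr]
      map_smul' := fun c y => by
        rw [RingHom.id_apply, ← Submodule.coe_smul]
        congr 1
        apply hinj
        rw [hr, T.map_smul, Submodule.coe_smul, smul_comm z c, ← smul_sub, hr] }
  refine ⟨R₀.mkContinuous δ⁻¹ fun y => ?_, fun x => ?_, fun y => ⟨r y, rfl, hr y⟩⟩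
  · rw [inv_mul_eq_div, le_div_iff₀' hδ]
    simpa [R₀, hr] using hbelow (r y)
  · exact congrArg Subtype.val (hinj _ _ (hr _))

variable [InnerProductSpace ℂ H]

/-- In the basis, `T - z` multiplies the coefficients by `μ n - z`, which stays away from 0.
Parseval gives the lower bound. The hypothesis `hsym`, required for every domain element, takes the
place of self-adjointness; closedness is needed only for surjectivity. -/
theorem mem_resolventSet_of_hilbertBasis {T : H →ₗ.[ℂ] H} (b : HilbertBasis ℕ ℂ H) {μ : ℕ → ℝ}
    (hlim : Tendsto μ atTop atTop)
    (he : ∀ n, ∃ x : T.domain, (x : H) = b n ∧ T x = (μ n : ℂ) • b n)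
    (hsym : ∀ n (x : T.domain), inner ℂ (b n) (T x) = (μ n : ℂ) * inner ℂ (b n) (x : H))
    (hcl : ∀ (x : ℕ → T.domain) (u v : H), Tendsto (fun k => (x k : H)) atTop (𝓝 u) →
      Tendsto (fun k => T (x k)) atTop (𝓝 v) → ∃ w : T.domain, (w : H) = u ∧ T w = v)
    {z : ℂ} (hz : ∀ n, z ≠ μ n) : z ∈ resolventSet T := by
  -- As `μ` tends to infinity, only finitely many `μ n` lie within distance 1 of `z`, and none
  -- equals `z`.
  obtain ⟨δ, hδ, hδμ⟩ : ∃ δ > 0, ∀ n, δ ≤ ‖(μ n : ℂ) - z‖ := by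
    have h1 : ∀ᶠ n in atTop, 1 ≤ ‖(μ n : ℂ) - z‖ := by
      filter_upwards [hlim.eventually_ge_atTop (1 + ‖z‖)] with n hn
      have h2 := norm_sub_norm_le (μ n : ℂ) z
      rw [Complex.norm_real, Real.norm_eq_abs] at h2
      linarith [le_abs_self (μ n)]
    obtain ⟨N, hN⟩ := eventually_atTop.1 h1
    have h3 : ∀ N : ℕ, ∃ δ > 0, ∀ n < N, δ ≤ ‖(μ n : ℂ) - z‖ := by
      intro N
      induction N with
      | zero => exact ⟨1, one_pos, by simp⟩
      | succ N ih =>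
        obtain ⟨δ, hδ, h⟩ := ih
        refine ⟨min δ ‖(μ N : ℂ) - z‖,
          lt_min hδ (norm_pos_iff.2 (sub_ne_zero.2 (hz N).symm)), fun n hn => ?_⟩
        rcases Nat.lt_succ_iff_lt_or_eq.1 hn with h' | rfl
        · exact (min_le_left _ _).trans (h n h')
        · exact min_le_right _ _
    obtain ⟨δ, hδ, h⟩ := h3 N
    refine ⟨min δ 1, lt_min hδ one_pos, fun n => ?_⟩
    rcases lt_or_ge n N with h' | h'
    · exact (min_le_left _ _).trans (h n h')
    · exact (min_le_right _ _).trans (hN n h')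
  have hcoef : ∀ n (x : T.domain),
      inner ℂ (b n) (T x - z • (x : H)) = ((μ n : ℂ) - z) * inner ℂ (b n) (x : H) := by
    intro n x
    rw [inner_sub_right, inner_smul_right, hsym, sub_mul]
  have hpars : ∀ x : H, HasSum (fun n => ‖inner ℂ (b n) x‖ ^ 2) (‖x‖ ^ 2) := by
    intro x
    have h := (b.hasSum_inner_mul_inner x x).mapL Complex.reCLM
    simp only [inner_self_eq_norm_sq_to_K] at h
    convert h using 1
    · funext n
      rw [Complex.reCLM_apply, ← inner_conj_symm x (b n), ← Complex.normSq_eq_conj_mul_self,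
        Complex.ofReal_re, Complex.normSq_eq_norm_sq]
    · rw [Complex.reCLM_apply]
      norm_cast
  refine mem_resolventSet_of_bounded_below hδ (fun x => ?_) (fun y => ?_)
  · refine le_of_sq_le_sq ?_ (norm_nonneg _)
    rw [mul_pow]
    refine hasSum_le (fun n => ?_) ((hpars (x : H)).mul_left (δ ^ 2)) (hpars _)
    rw [hcoef, norm_mul, mul_pow]
    gcongr
    exact hδμ n
  -- Coefficients of the solution. Its partial sums `p N` lie in the domain and both `p N` and `T (p
  -- N)` converge, so `hcl` applies.
  · set c : ℕ → ℂ := fun n => ((μ n : ℂ) - z)⁻¹ * inner ℂ (b n) y with hc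
    have hmem : Memℓp c 2 := by
      refine memℓp_gen ?_
      refine Summable.of_nonneg_of_le (fun n => by positivity) (fun n => ?_)
        ((hpars y).summable.mul_left ((δ⁻¹) ^ 2))
      simp only [hc, ENNReal.toReal_ofNat, Real.rpow_ofNat]
      rw [norm_mul, mul_pow, norm_inv]
      gcongr
      exact hδμ n
    have hs := b.hasSum_repr_symm ⟨c, hmem⟩
    choose x hx hTx using he
    let p : ℕ → T.domain := fun N => ∑ n ∈ Finset.range N, c n • x n
    have hp : ∀ N, (p N : H) = ∑ n ∈ Finset.range N, c n • b n := by
      intro N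
      simp [p, hx]
    have hTp : ∀ N, T (p N) = (∑ n ∈ Finset.range N, inner ℂ (b n) y • b n) + z • (p N : H) := by
      intro N
      have h1 : T (p N) = ∑ n ∈ Finset.range N, c n • T (x n) := by
        change T.toFun (p N) = _
        simp only [p, map_sum, map_smul]
        rfl
      rw [h1, hp, Finset.smul_sum, ← Finset.sum_add_distrib]
      refine Finset.sum_congr rfl fun n _ => ?_
      rw [hTx, smul_smul, smul_smul, ← add_smul]
      congr 1
      have : (μ n : ℂ) - z ≠ 0 := sub_ne_zero.2 (hz n).symm
      simp only [hc]
      field_simp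
      ring
    have hlim1 : Tendsto (fun N => (p N : H)) atTop (𝓝 (b.repr.symm ⟨c, hmem⟩)) := by
      simp only [hp]
      exact hs.tendsto_sum_nat
    have hlim2 : Tendsto (fun N => T (p N)) atTop
        (𝓝 (y + z • b.repr.symm ⟨c, hmem⟩)) := by
      simp only [hTp]
      refine Tendsto.add ?_ (hlim1.const_smul z)
      simpa only [b.repr_apply_apply] using (b.hasSum_repr y).tendsto_sum_nat
    obtain ⟨w, hw, hTw⟩ := hcl p _ _ hlim1 hlim2
    exact ⟨w, by rw [hTw, hw]; abel⟩

/-- The spectrum of a closed operator with a total family of eigenvectors, on which it is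
symmetric, and with simple real eigenvalues that tend to infinity. -/
theorem spectrum_of_total_eigenfamily [CompleteSpace H] {T : H →ₗ.[ℂ] H} {e : ℕ → H} {μ : ℕ → ℝ}
    (hμ : Function.Injective μ) (hlim : Tendsto μ atTop atTop) (he0 : ∀ n, e n ≠ 0)
    (he : ∀ n, ∃ x : T.domain, (x : H) = e n ∧ T x = (μ n : ℂ) • e n)
    (hsym : ∀ n (x : T.domain), inner ℂ (e n) (T x) = (μ n : ℂ) * inner ℂ (e n) (x : H))
    (htot : ∀ y : H, (∀ n, inner ℂ (e n) y = 0) → y = 0)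
    (hcl : ∀ (x : ℕ → T.domain) (u v : H), Tendsto (fun k => (x k : H)) atTop (𝓝 u) →
      Tendsto (fun k => T (x k)) atTop (𝓝 v) → ∃ w : T.domain, (w : H) = u ∧ T w = v) :
    spectrum T = pointSpectrum T ∧ pointSpectrum T = {z | ∃ n, z = (μ n : ℂ)} ∧
      ∀ n, eigenspace T (μ n) = Submodule.span ℂ {e n} := by
  -- The eigenvalue of `e n` and `hsym` at `m` evaluate the inner product of `e m` with `T (e n)` in
  -- two ways.
  have horth : ∀ m n, m ≠ n → inner ℂ (e m) (e n) = 0 := by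
    intro m n hmn
    obtain ⟨x, hx, hTx⟩ := he n
    have h := hsym m x
    rw [hTx, hx, inner_smul_right, ← sub_eq_zero, ← sub_mul] at h
    refine (mul_eq_zero.1 h).resolve_left ?_
    rw [sub_eq_zero, Complex.ofReal_inj]
    exact fun h' => hmn (hμ h'.symm)
  have heig : ∀ n, eigenspace T (μ n) = Submodule.span ℂ {e n} := by
    intro n
    apply le_antisymm
    · intro y hy
      obtain ⟨x, rfl, hx⟩ := mem_eigenspace_iff.1 hy
      have hne : inner ℂ (e n) (e n) ≠ 0 := inner_self_ne_zero.2 (he0 n)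
      rw [Submodule.mem_span_singleton]
      refine ⟨inner ℂ (e n) (x : H) / inner ℂ (e n) (e n), ?_⟩
      rw [eq_comm, ← sub_eq_zero]
      -- An eigenvector minus its projection on `e n` is orthogonal to the whole family.
      refine htot _ fun m => ?_
      rw [inner_sub_right, inner_smul_right]
      by_cases hmn : m = n
      · subst hmn
        field_simp
        ring
      · have h := hsym m x
        rw [hx, inner_smul_right, ← sub_eq_zero, ← sub_mul] at h
        rw [horth m n hmn, mul_zero, sub_zero]
        refine (mul_eq_zero.1 h).resolve_left ?_
        rw [sub_eq_zero, Complex.ofReal_inj]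
        exact fun h' => hmn (hμ h'.symm)
    · rw [Submodule.span_singleton_le_iff_mem, mem_eigenspace_iff]
      obtain ⟨x, hx, hTx⟩ := he n
      exact ⟨x, hx, by rw [hTx, hx]⟩
  have hsub : ∀ n, (μ n : ℂ) ∈ pointSpectrum T := fun n => by
    change eigenspace T (μ n) ≠ ⊥
    rw [heig, Ne, Submodule.span_singleton_eq_bot]
    exact he0 n
  let v : ℕ → H := fun n => ((‖e n‖⁻¹ : ℝ) : ℂ) • e n
  have hnz : ∀ n, ((‖e n‖⁻¹ : ℝ) : ℂ) ≠ 0 := fun n => by simpa using he0 n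
  have hv : Orthonormal ℂ v := by
    refine ⟨fun n => ?_, fun m n hmn => ?_⟩
    · have : ‖e n‖ ≠ 0 := norm_ne_zero_iff.2 (he0 n)
      simp [v, norm_smul, this]
    · change inner ℂ (v m) (v n) = 0
      simp only [v, inner_smul_left, inner_smul_right, horth m n hmn, mul_zero]
  have hperp : (Submodule.span ℂ (Set.range v))ᗮ = ⊥ := by
    refine (Submodule.eq_bot_iff _).2 fun y hy => htot y fun n => ?_
    have h := (Submodule.mem_orthogonal _ y).1 hy (v n) (Submodule.subset_span ⟨n, rfl⟩)
    simp only [v, inner_smul_left] at h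
    exact (mul_eq_zero.1 h).resolve_left (by simpa using he0 n)
  let b := HilbertBasis.mkOfOrthogonalEqBot hv hperp
  have hb : ∀ n, b n = v n := fun n =>
    congrFun (HilbertBasis.coe_mkOfOrthogonalEqBot hv hperp) n
  have hres : spectrum T ⊆ {z | ∃ n, z = (μ n : ℂ)} := by
    intro z hz
    by_contra h
    refine hz (mem_resolventSet_of_hilbertBasis b hlim (fun n => ?_) (fun n x => ?_) hcl
      (fun n hn => h ⟨n, hn⟩))
    · obtain ⟨x, hx, hTx⟩ := he n
      refine ⟨((‖e n‖⁻¹ : ℝ) : ℂ) • x, ?_, ?_⟩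
      · rw [hb, Submodule.coe_smul, hx]
      · rw [hb, T.map_smul, hTx, smul_comm]
    · rw [hb]
      simp only [v, inner_smul_left]
      rw [hsym]
      ring
  have hpt : {z | ∃ n, z = (μ n : ℂ)} ⊆ pointSpectrum T := by
    rintro z ⟨n, rfl⟩
    exact hsub n
  exact ⟨(hres.trans hpt).antisymm (pointSpectrum_subset_spectrum T),
    ((pointSpectrum_subset_spectrum T).trans hres).antisymm hpt, heig⟩

end AbstractSpectrum

/-! ### Complex-valued absolutely continuous functions -/

section AbsoluteContinuity

theorem absolutelyContinuousOnInterval_ofReal {f : ℝ → ℝ} {a b : ℝ}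
    (hf : AbsolutelyContinuousOnInterval f a b) :
    AbsolutelyContinuousOnInterval (fun t => (f t : ℂ)) a b := by
  simpa [AbsolutelyContinuousOnInterval, dist_eq_norm, ← Complex.ofReal_sub] using hf

/-- The real-valued result is applied to real and imaginary parts, which are then recombined on the
interval. -/
theorem absolutelyContinuousOnInterval_integral {h : ℝ → ℂ} {a b c : ℝ}
    (hh : IntervalIntegrable h volume a b) (hc : c ∈ uIcc a b) :
    AbsolutelyContinuousOnInterval (fun t => ∫ s in c..t, h s) a b := by
  have hre : IntervalIntegrable (fun s => (h s).re) volume a b :=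
    ⟨hh.1.re, hh.2.re⟩
  have him : IntervalIntegrable (fun s => (h s).im) volume a b :=
    ⟨hh.1.im, hh.2.im⟩
  have h1 := (absolutelyContinuousOnInterval_ofReal
    (hre.absolutelyContinuousOnInterval_intervalIntegral hc)).add
    ((absolutelyContinuousOnInterval_ofReal
      (him.absolutelyContinuousOnInterval_intervalIntegral hc)).const_smul Complex.I)
  refine (tendsto_congr' ?_).1 h1
  refine mem_inf_of_right ?_
  have key : ∀ t ∈ uIcc a b, ((fun t => ((∫ s in c..t, (h s).re : ℝ) : ℂ)) +
      Complex.I • fun t => ((∫ s in c..t, (h s).im : ℝ) : ℂ)) t = ∫ s in c..t, h s := by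
    intro t ht
    have hi : IntervalIntegrable h volume c t := hh.mono_set (uIcc_subset_uIcc hc ht)
    have e1 : (∫ s in c..t, (h s).re) = (∫ s in c..t, h s).re :=
      Complex.reCLM.intervalIntegral_comp_comm hi
    have e2 : (∫ s in c..t, (h s).im) = (∫ s in c..t, h s).im :=
      Complex.imCLM.intervalIntegral_comp_comm hi
    simp only [Pi.add_apply, Pi.smul_apply, smul_eq_mul, e1, e2]
    rw [mul_comm]
    exact Complex.re_add_im _
  intro E hE
  refine Finset.sum_congr rfl fun i hi => ?_
  exact congrArg₂ dist (key _ (hE.1 i hi).1) (key _ (hE.1 i hi).2)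

/-- The fundamental theorem of calculus for absolutely continuous complex functions. -/
theorem integral_eq_sub_of_ae_hasDerivAt {w φ : ℝ → ℂ} {a b : ℝ}
    (hw : AbsolutelyContinuousOnInterval w a b)
    (hd : ∀ᵐ t, t ∈ uIcc a b → HasDerivAt w (φ t) t) (hφ : IntervalIntegrable φ volume a b) :
    ∫ t in a..b, φ t = w b - w a := by
  -- The difference of `w` and the primitive of `φ` is absolutely continuous with derivative zero
  -- almost everywhere, hence constant.
  have hg := hw.sub (absolutelyContinuousOnInterval_integral hφ left_mem_uIcc)
  obtain ⟨C, hC⟩ := hg.const_of_ae_hasDerivAt_zero (by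
    filter_upwards [hd, hφ.ae_hasDerivAt_integral] with t h1 h2 ht
    have := (h1 ht).sub (h2 ht a left_mem_uIcc)
    rwa [sub_self] at this)
  have h1 := hC a left_mem_uIcc
  have h2 := hC b right_mem_uIcc
  simp only [Pi.sub_apply, intervalIntegral.integral_same, sub_zero] at h1 h2
  rw [h1, ← h2]
  abel

end AbsoluteContinuity

/-! ### The double primitive and its bounds -/

section SecondPrimitive

variable {S : TopologicalSpace.Opens ℝ}

/-- The second derivative of `f`, expressed by `f` and `g = expr f`, and extended by zero. -/
def secondDeriv (f g : L2 S) : ℝ → ℂ :=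
  (S : Set ℝ).indicator fun s => (s : ℂ) ^ 2 * f s - 2 * g s

/-- The base point 0 will be the endpoint of the half line. Extension by zero makes the integral
meaningful on all of `ℝ`, and local integrability up to 0 makes the boundary values the constants of
integration. -/
def firstPrim (f g : L2 S) (t : ℝ) : ℂ := ∫ s in (0 : ℝ)..t, secondDeriv f g s

def secondPrim (f g : L2 S) (t : ℝ) : ℂ := ∫ s in (0 : ℝ)..t, firstPrim f g s

theorem memLp_indicator (f : L2 S) : MemLp ((S : Set ℝ).indicator f) 2 volume :=
  (memLp_indicator_iff_restrict S.isOpen.measurableSet).2 (Lp.memLp f)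

theorem intervalIntegrable_indicator (f : L2 S) (a b : ℝ) :
    IntervalIntegrable ((S : Set ℝ).indicator f) volume a b :=
  (((memLp_indicator f).locallyIntegrable one_le_two).integrableOn_isCompact
    isCompact_uIcc).intervalIntegrable

theorem secondDeriv_eq (f g : L2 S) : secondDeriv f g = fun s : ℝ =>
    (s : ℂ) ^ 2 * (S : Set ℝ).indicator f s - 2 * (S : Set ℝ).indicator g s := by
  funext s
  by_cases hs : s ∈ (S : Set ℝ) <;> simp [secondDeriv, hs]

theorem locallyIntegrable_secondDeriv (f g : L2 S) :
    LocallyIntegrable (secondDeriv f g) volume := by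
  rw [secondDeriv_eq]
  have h1 := (memLp_indicator f).locallyIntegrable one_le_two
  have h2 := (memLp_indicator g).locallyIntegrable one_le_two
  exact (h1.continuous_mul (by fun_prop)).sub (h2.continuous_mul continuous_const)

theorem intervalIntegrable_secondDeriv (f g : L2 S) (a b : ℝ) :
    IntervalIntegrable (secondDeriv f g) volume a b := by
  rw [secondDeriv_eq]
  exact ((intervalIntegrable_indicator f a b).continuousOn_mul (by fun_prop)).sub
    ((intervalIntegrable_indicator g a b).const_mul 2)

/-- Cauchy–Schwarz on an interval of length `|t|`. -/
theorem integral_norm_indicator_le (f : L2 S) (t : ℝ) :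
    ∫ s in uIoc 0 t, ‖(S : Set ℝ).indicator f s‖ ≤ √|t| * ‖f‖ := by
  have hm := memLp_indicator f
  have hfin : volume (uIoc 0 t) = ENNReal.ofReal |t| := by
    rw [Real.volume_uIoc, sub_zero]
  have hsm := hm.1.restrict (s := uIoc 0 t)
  have h1 := eLpNorm_le_eLpNorm_mul_rpow_measure_univ (p := 1) (q := 2) one_le_two hsm
  have h2 : eLpNorm ((S : Set ℝ).indicator f) 2 (volume.restrict (uIoc 0 t)) ≤
      ENNReal.ofReal ‖f‖ := by
    refine (eLpNorm_restrict_le _ _ _ _).trans ?_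
    rw [eLpNorm_indicator_eq_eLpNorm_restrict S.isOpen.measurableSet, Lp.norm_def,
      ENNReal.ofReal_toReal (Lp.eLpNorm_ne_top f)]
  rw [integral_norm_eq_lintegral_enorm hsm, ← eLpNorm_one_eq_lintegral_enorm]
  refine ENNReal.toReal_le_of_le_ofReal (by positivity) (h1.trans ?_)
  rw [mul_comm, ENNReal.ofReal_mul (Real.sqrt_nonneg _)]
  refine mul_le_mul' ?_ h2
  rw [Measure.restrict_apply_univ, hfin, Real.sqrt_eq_rpow,
    ENNReal.ofReal_rpow_of_nonneg (abs_nonneg t) (by norm_num)]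
  norm_num

theorem integral_norm_secondDeriv_le (f g : L2 S) (t : ℝ) :
    ∫ s in uIoc 0 t, ‖secondDeriv f g s‖ ≤ √|t| * (t ^ 2 * ‖f‖ + 2 * ‖g‖) := by
  have hf := (intervalIntegrable_indicator f 0 t).def'.norm
  have hg := (intervalIntegrable_indicator g 0 t).def'.norm
  calc ∫ s in uIoc 0 t, ‖secondDeriv f g s‖
      ≤ ∫ s in uIoc 0 t, (t ^ 2 * ‖(S : Set ℝ).indicator f s‖ +
          2 * ‖(S : Set ℝ).indicator g s‖) := by
        refine setIntegral_mono_on (intervalIntegrable_secondDeriv f g 0 t).def'.norm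
          ((hf.const_mul _).add (hg.const_mul _)) measurableSet_uIoc fun s hs => ?_
        rw [secondDeriv_eq]
        refine (norm_sub_le _ _).trans ?_
        rw [norm_mul, norm_mul, norm_pow, Complex.norm_real, Real.norm_eq_abs,
          Complex.norm_ofNat]
        have : |s| ≤ |t| := by
          rcases mem_uIoc.1 hs with h | h
          · rw [abs_of_pos h.1, abs_of_pos (h.1.trans_le h.2)]; exact h.2
          · rw [abs_of_nonpos h.2, abs_of_neg (h.1.trans_le h.2)]; linarith [h.1]
        rw [← sq_abs t]
        gcongr
    _ = t ^ 2 * (∫ s in uIoc 0 t, ‖(S : Set ℝ).indicator f s‖) +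
          2 * ∫ s in uIoc 0 t, ‖(S : Set ℝ).indicator g s‖ := by
        have h1 : Integrable (fun s => t ^ 2 * ‖(S : Set ℝ).indicator f s‖)
            (volume.restrict (uIoc 0 t)) := hf.const_mul _
        have h2 : Integrable (fun s => 2 * ‖(S : Set ℝ).indicator g s‖)
            (volume.restrict (uIoc 0 t)) := hg.const_mul _
        rw [integral_add h1 h2, integral_const_mul, integral_const_mul]
    _ ≤ t ^ 2 * (√|t| * ‖f‖) + 2 * (√|t| * ‖g‖) := by
        gcongr <;> exact integral_norm_indicator_le _ t
    _ = _ := by ring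

theorem norm_firstPrim_le (f g : L2 S) (t : ℝ) :
    ‖firstPrim f g t‖ ≤ √|t| * (t ^ 2 * ‖f‖ + 2 * ‖g‖) :=
  intervalIntegral.norm_integral_le_integral_norm_uIoc.trans (integral_norm_secondDeriv_le f g t)

theorem norm_secondPrim_le (f g : L2 S) (t : ℝ) :
    ‖secondPrim f g t‖ ≤ √|t| * (t ^ 2 * ‖f‖ + 2 * ‖g‖) * |t| := by
  have h := intervalIntegral.norm_integral_le_of_norm_le_const (a := 0) (b := t)
    (f := firstPrim f g) (C := √|t| * (t ^ 2 * ‖f‖ + 2 * ‖g‖)) fun s hs => ?_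
  · simpa [secondPrim] using h
  · have : |s| ≤ |t| := by
      rcases mem_uIoc.1 hs with h | h
      · rw [abs_of_pos h.1, abs_of_pos (h.1.trans_le h.2)]; exact h.2
      · rw [abs_of_nonpos h.2, abs_of_neg (h.1.trans_le h.2)]; linarith [h.1]
    refine (norm_firstPrim_le f g s).trans ?_
    rw [← sq_abs t, ← sq_abs s]
    gcongr

theorem continuous_firstPrim (f g : L2 S) : Continuous (firstPrim f g) :=
  intervalIntegral.continuous_primitive (intervalIntegrable_secondDeriv f g) 0

theorem hasDerivAt_secondPrim (f g : L2 S) (t : ℝ) :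
    HasDerivAt (secondPrim f g) (firstPrim f g t) t :=
  intervalIntegral.integral_hasDerivAt_right ((continuous_firstPrim f g).intervalIntegrable _ _)
    ((continuous_firstPrim f g).stronglyMeasurableAtFilter _ _) (continuous_firstPrim f g).continuousAt

theorem absolutelyContinuousOnInterval_const_add_firstPrim (f g : L2 S) (b : ℂ) (c d : ℝ) :
    AbsolutelyContinuousOnInterval (fun t => b + firstPrim f g t) c d := by
  have h1 := absolutelyContinuousOnInterval_integral
    (intervalIntegrable_secondDeriv f g c d) left_mem_uIcc
  have h2 : AbsolutelyContinuousOnInterval (fun _ : ℝ => b + firstPrim f g c) c d :=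
    contDiff_const.contDiffOn.absolutelyContinuousOnInterval
  convert! h2.add h1 using 1
  funext t
  have := intervalIntegral.integral_add_adjacent_intervals
    (intervalIntegrable_secondDeriv f g 0 c) (intervalIntegrable_secondDeriv f g c t)
  simp only [firstPrim, Pi.add_apply]
  rw [← this]
  ring

theorem firstPrim_sub (f g f' g' : L2 S) (t : ℝ) :
    firstPrim (f - f') (g - g') t = firstPrim f g t - firstPrim f' g' t := by
  rw [firstPrim, firstPrim, firstPrim, ← intervalIntegral.integral_sub
    (intervalIntegrable_secondDeriv f g 0 t) (intervalIntegrable_secondDeriv f' g' 0 t)]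
  refine intervalIntegral.integral_congr_ae ?_
  have h1 := (ae_restrict_iff' S.isOpen.measurableSet).1 (Lp.coeFn_sub f f')
  have h2 := (ae_restrict_iff' S.isOpen.measurableSet).1 (Lp.coeFn_sub g g')
  filter_upwards [h1, h2] with s e1 e2 _
  by_cases hs : s ∈ (S : Set ℝ)
  · simp only [secondDeriv, indicator_of_mem hs, e1 hs, e2 hs, Pi.sub_apply]
    ring
  · simp [secondDeriv, indicator_of_notMem hs]

theorem secondPrim_sub (f g f' g' : L2 S) (t : ℝ) :
    secondPrim (f - f') (g - g') t = secondPrim f g t - secondPrim f' g' t := by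
  rw [secondPrim, secondPrim, secondPrim, ← intervalIntegral.integral_sub
    ((continuous_firstPrim f g).intervalIntegrable 0 t)
    ((continuous_firstPrim f' g').intervalIntegrable 0 t)]
  exact intervalIntegral.integral_congr fun s _ => firstPrim_sub f g f' g' s

theorem tendsto_secondPrim {f g : ℕ → L2 S} {f' g' : L2 S} (hf : Tendsto f atTop (𝓝 f'))
    (hg : Tendsto g atTop (𝓝 g')) (t : ℝ) :
    Tendsto (fun k => secondPrim (f k) (g k) t) atTop (𝓝 (secondPrim f' g' t)) := by
  rw [tendsto_iff_norm_sub_tendsto_zero] at hf hg ⊢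
  refine squeeze_zero (fun k => norm_nonneg _) (fun k => ?_)
    (g := fun k => √|t| * (t ^ 2 * ‖f k - f'‖ + 2 * ‖g k - g'‖) * |t|) ?_
  · rw [← secondPrim_sub]
    exact norm_secondPrim_le _ _ t
  · simpa using (((hf.const_mul (t ^ 2)).add (hg.const_mul 2)).const_mul (√|t|)).mul_const |t|

end SecondPrimitive

/-! ### Representation of the maximal domain -/

section MaximalDomain

variable {S : TopologicalSpace.Opens ℝ}

theorem deriv_deriv_eq (u : ℝ → ℂ) (t : ℝ) :
    deriv (deriv u) t = (t : ℂ) ^ 2 * u t - 2 * expr u t := by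
  simp only [expr]
  ring

/-- A function of the maximal domain is recovered from its boundary values and the second
primitive. -/
theorem IsMax.eq_secondPrim (hS : (S : Set ℝ).OrdConnected) [(𝓝[(S : Set ℝ)] (0 : ℝ)).NeBot]
    {u : ℝ → ℂ} (hu : IsMax S u) {f g : L2 S} (hf : f =ᵐ[volume.restrict (S : Set ℝ)] u)
    (hg : g =ᵐ[volume.restrict (S : Set ℝ)] expr u) {a b : ℂ}
    (ha : Tendsto u (𝓝[(S : Set ℝ)] 0) (𝓝 a)) (hb : Tendsto (deriv u) (𝓝[(S : Set ℝ)] 0) (𝓝 b))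
    {t : ℝ} (ht : t ∈ S) :
    deriv u t = b + firstPrim f g t ∧ u t = a + b * t + secondPrim f g t := by
  have hderiv : ∀ s ∈ S, deriv u s = b + firstPrim f g s := by
    intro s hs
    -- Since `S` is an interval, the difference is constant on it; letting `r` tend to 0 identifies
    -- the constant as `b`. The same argument is then repeated for `w`.
    have hconst : ∀ r ∈ S, deriv u r - firstPrim f g r = deriv u s - firstPrim f g s := by
      intro r hr
      have hsub : uIcc r s ⊆ (S : Set ℝ) := hS.uIcc_subset hr hs
      have hd : ∀ᵐ x, x ∈ uIcc r s → HasDerivAt (deriv u) (secondDeriv f g x) x := by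
        filter_upwards [(ae_restrict_iff' S.isOpen.measurableSet).1 hu.ac_deriv.ae_diff,
          (ae_restrict_iff' S.isOpen.measurableSet).1 hf,
          (ae_restrict_iff' S.isOpen.measurableSet).1 hg] with x h1 h2 h3 hx
        have hxS := hsub hx
        have := (h1 hxS).hasDerivAt
        rw [deriv_deriv_eq, ← h2 hxS, ← h3 hxS] at this
        simpa [secondDeriv, indicator_of_mem hxS] using this
      have h := integral_eq_sub_of_ae_hasDerivAt (hu.ac_deriv r s hsub) hd
        (intervalIntegrable_secondDeriv f g r s)
      have h' := intervalIntegral.integral_add_adjacent_intervals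
        (intervalIntegrable_secondDeriv f g 0 r) (intervalIntegrable_secondDeriv f g r s)
      simp only [firstPrim]
      linear_combination h - h'
    have hlim : Tendsto (fun r => deriv u r - firstPrim f g r) (𝓝[(S : Set ℝ)] 0)
        (𝓝 (b - firstPrim f g 0)) :=
      hb.sub ((continuous_firstPrim f g).tendsto 0 |>.mono_left nhdsWithin_le_nhds)
    have h0 : firstPrim f g 0 = 0 := by simp [firstPrim]
    have := tendsto_nhds_unique (hlim.congr' (f₂ := fun _ => deriv u s - firstPrim f g s)
      (by filter_upwards [self_mem_nhdsWithin] with r hr using hconst r hr)) tendsto_const_nhds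
    rw [h0] at this
    linear_combination -this
  refine ⟨hderiv t ht, ?_⟩
  set w : ℝ → ℂ := fun s => u s - b * s - secondPrim f g s with hw
  have hwd : ∀ s ∈ S, HasDerivAt w 0 s := by
    intro s hs
    have h1 := (((hu.diff s hs).hasDerivAt).sub
      ((Complex.ofRealCLM.hasDerivAt (x := s)).const_mul b)).sub (hasDerivAt_secondPrim f g s)
    convert! h1 using 1
    rw [hderiv s hs]
    simp
  have hconst : ∀ r ∈ S, w r = w t := fun r hr =>
    S.isOpen.is_const_of_deriv_eq_zero hS.isPreconnected
      (fun s hs => (hwd s hs).differentiableAt.differentiableWithinAt)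
      (fun s hs => (hwd s hs).deriv) hr ht
  have hlim : Tendsto w (𝓝[(S : Set ℝ)] 0) (𝓝 (a - b * (0 : ℝ) - secondPrim f g 0)) := by
    refine (ha.sub ?_).sub ?_
    · exact ((by fun_prop : Continuous fun s : ℝ => b * (s : ℂ)).tendsto 0).mono_left
        nhdsWithin_le_nhds
    · exact (hasDerivAt_secondPrim f g 0).continuousAt.tendsto.mono_left nhdsWithin_le_nhds
  have h0 : secondPrim f g 0 = 0 := by simp [secondPrim]
  have := tendsto_nhds_unique (hlim.congr' (f₂ := fun _ => w t)
      (by filter_upwards [self_mem_nhdsWithin] with r hr using hconst r hr)) tendsto_const_nhds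
  rw [h0] at this
  simp only [hw, Complex.ofReal_zero] at this
  linear_combination -this

/-- Converse of `IsMax.eq_secondPrim`. The integral formula is C¹ on the whole line and its
derivative is a primitive of `secondDeriv f g`; it provides a good representative for the limit in
the closedness proof. -/
theorem isMax_secondPrim {f g : L2 S} {a b : ℂ} (hf : f =ᵐ[volume.restrict (S : Set ℝ)]
      fun t : ℝ => a + b * t + secondPrim f g t) :
    IsMax S (fun t : ℝ => a + b * t + secondPrim f g t) ∧
      g =ᵐ[volume.restrict (S : Set ℝ)] expr (fun t : ℝ => a + b * t + secondPrim f g t) ∧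
      deriv (fun t : ℝ => a + b * t + secondPrim f g t) = fun t => b + firstPrim f g t := by
  set u : ℝ → ℂ := fun t : ℝ => a + b * t + secondPrim f g t with hu
  have hd : ∀ t, HasDerivAt u (b + firstPrim f g t) t := by
    intro t
    have h1 := (((Complex.ofRealCLM.hasDerivAt (x := t)).const_mul b).const_add a).add
      (hasDerivAt_secondPrim f g t)
    convert! h1 using 1
    simp
  have hderiv : deriv u = fun t => b + firstPrim f g t := funext fun t => (hd t).deriv
  have hC1 : ContDiff ℝ 1 u := by
    rw [contDiff_one_iff_deriv]
    refine ⟨fun t => (hd t).differentiableAt, ?_⟩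
    rw [hderiv]
    exact continuous_const.add (continuous_firstPrim f g)
  have hdd : ∀ᵐ t, HasDerivAt (deriv u) (secondDeriv f g t) t := by
    filter_upwards [LocallyIntegrable.ae_hasDerivAt_integral (locallyIntegrable_secondDeriv f g)] with t ht
    rw [hderiv]
    exact (ht 0).const_add b
  have hexpr : g =ᵐ[volume.restrict (S : Set ℝ)] expr u := by
    filter_upwards [hf, ae_restrict_of_ae hdd, ae_restrict_mem S.isOpen.measurableSet]
      with t h1 h2 h3
    rw [expr, h2.deriv, secondDeriv, indicator_of_mem h3, h1]
    ring
  refine ⟨⟨fun c d _ => hC1.contDiffOn.absolutelyContinuousOnInterval,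
    fun t _ => (hd t).differentiableAt, fun c d _ => ?_, ?_, ?_⟩, hexpr, hderiv⟩
  · rw [hderiv]
    exact absolutelyContinuousOnInterval_const_add_firstPrim f g b c d
  · exact (memLp_congr_ae hf).1 (Lp.memLp f)
  · exact (memLp_congr_ae hexpr).1 (Lp.memLp g)

end MaximalDomain

/-! ### Closedness of the operators -/

section Closed

variable {S : TopologicalSpace.Opens ℝ} {θ : ℝ}

theorem exists_rep_of_mem_domain (x : (oscillator S θ).domain) :
    ∃ u : ℝ → ℂ, IsMax S u ∧ (x : L2 S) =ᵐ[volume.restrict (S : Set ℝ)] u ∧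
      oscillator S θ x =ᵐ[volume.restrict (S : Set ℝ)] expr u ∧
      ∃ a b : ℂ, Tendsto u (𝓝[(S : Set ℝ)] 0) (𝓝 a) ∧
        Tendsto (deriv u) (𝓝[(S : Set ℝ)] 0) (𝓝 b) ∧
        (Real.cos θ : ℂ) * a = (Real.sin θ : ℂ) * b := by
  obtain ⟨u, hu, hxu, hab⟩ := x.2.1
  refine ⟨u, hu, hxu, ?_, hab⟩
  have h : oscillator S θ x = maxFun S ⟨x, x.2.2⟩ := rfl
  rw [h, maxFun_eq ⟨x, x.2.2⟩ hu hxu]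
  exact MemLp.coeFn_toLp _

theorem exists_mem_domain_of_rep {f g : L2 S} {u : ℝ → ℂ} (hu : IsMax S u)
    (hf : f =ᵐ[volume.restrict (S : Set ℝ)] u) (hg : g =ᵐ[volume.restrict (S : Set ℝ)] expr u)
    {a b : ℂ} (ha : Tendsto u (𝓝[(S : Set ℝ)] 0) (𝓝 a))
    (hb : Tendsto (deriv u) (𝓝[(S : Set ℝ)] 0) (𝓝 b))
    (hab : (Real.cos θ : ℂ) * a = (Real.sin θ : ℂ) * b) :
    ∃ x : (oscillator S θ).domain, (x : L2 S) = f ∧ oscillator S θ x = g := by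
  have hm : f ∈ maxDomain S := ⟨u, hu, hf⟩
  refine ⟨⟨f, ⟨u, hu, hf, a, b, ha, hb, hab⟩, hm⟩, rfl, ?_⟩
  have h : oscillator S θ ⟨f, ⟨u, hu, hf, a, b, ha, hb, hab⟩, hm⟩ = maxFun S ⟨f, hm⟩ := rfl
  rw [h, maxFun_eq ⟨f, hm⟩ hu hf]
  exact Lp.ext ((MemLp.coeFn_toLp _).trans hg.symm)

/-- An affine function whose coefficients `sin θ` and `cos θ` are not both zero has at most one
root. -/
theorem countable_boundary_line (θ : ℝ) :
    {t : ℝ | ((Real.sin θ : ℂ) + Real.cos θ * t) = 0}.Countable := by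
  refine Set.Subsingleton.countable fun s hs t ht => ?_
  simp only [mem_ofPred_eq] at hs ht
  norm_cast at hs ht
  by_cases hc : Real.cos θ = 0
  · rw [hc] at hs
    have := Real.sin_sq_add_cos_sq θ
    rw [hc] at this
    nlinarith
  · have : Real.cos θ * s = Real.cos θ * t := by linarith
    exact mul_left_cancel₀ hc this

/-- The operators `A_{±,θ}` are closed. -/
theorem oscillator_closed (hS : (S : Set ℝ).OrdConnected) [(𝓝[(S : Set ℝ)] (0 : ℝ)).NeBot]
    (x : ℕ → (oscillator S θ).domain) (f g : L2 S)
    (hx : Tendsto (fun k => (x k : L2 S)) atTop (𝓝 f))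
    (hTx : Tendsto (fun k => oscillator S θ (x k)) atTop (𝓝 g)) :
    ∃ w : (oscillator S θ).domain, (w : L2 S) = f ∧ oscillator S θ w = g := by
  choose u hu hxu hTu a b ha hb hab using fun k => exists_rep_of_mem_domain (x k)
  -- The boundary condition says that `(a k, b k)` is a multiple of the unit vector `(sin θ, cos
  -- θ)`, with factor `c k`. So the affine part of `u k` is `c k * p`, with a single unknown scalar.
  set p : ℝ → ℂ := fun t => (Real.sin θ : ℂ) + Real.cos θ * t with hp
  set c : ℕ → ℂ := fun k => Real.sin θ * a k + Real.cos θ * b k with hc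
  have htrig : (Real.sin θ : ℂ) ^ 2 + (Real.cos θ : ℂ) ^ 2 = 1 := by
    exact_mod_cast Real.sin_sq_add_cos_sq θ
  have hrep : ∀ k, ∀ t ∈ S, u k t = c k * p t + secondPrim (x k : L2 S) (oscillator S θ (x k)) t := by
    intro k t ht
    rw [((hu k).eq_secondPrim hS (hxu k) (hTu k) (ha k) (hb k) ht).2]
    simp only [hc, hp]
    linear_combination (-(a k + b k * t)) * htrig + (Real.cos θ - Real.sin θ * t) * hab k
  obtain ⟨ns, hns, hae⟩ := (tendstoInMeasure_of_tendsto_Lp hx).exists_seq_tendsto_ae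
  have hall : ∀ᵐ t ∂(volume.restrict (S : Set ℝ)), Tendsto (fun k => c (ns k) * p t) atTop
      (𝓝 (f t - secondPrim f g t)) := by
    filter_upwards [hae, ae_all_iff.2 hxu, ae_restrict_mem S.isOpen.measurableSet]
      with t h1 h2 h3
    refine (h1.sub (tendsto_secondPrim (hx.comp hns.tendsto_atTop)
      (hTx.comp hns.tendsto_atTop) t)).congr fun k => ?_
    simp only [Function.comp_apply]
    rw [h2, hrep _ t h3]
    ring
  have hne : (ae (volume.restrict (S : Set ℝ))).NeBot := by
    rw [ae_neBot, Ne, Measure.restrict_eq_zero]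
    obtain ⟨s, hs⟩ : (S : Set ℝ).Nonempty :=
      (self_mem_nhdsWithin : (S : Set ℝ) ∈ 𝓝[(S : Set ℝ)] (0 : ℝ)) |> Filter.nonempty_of_mem
    exact (S.isOpen.measure_pos volume ⟨s, hs⟩).ne'
  have hpne : ∀ᵐ t ∂(volume.restrict (S : Set ℝ)), p t ≠ 0 :=
    ae_restrict_of_ae ((countable_boundary_line θ).ae_notMem volume)
  obtain ⟨t₀, ht₀, hpt₀⟩ := (hall.and hpne).exists
  set c₀ : ℂ := (f t₀ - secondPrim f g t₀) / p t₀ with hc₀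
  -- Convergence at the single point `t₀`, where `p` does not vanish, already forces the scalars to
  -- converge.
  have hclim : Tendsto (fun k => c (ns k)) atTop (𝓝 c₀) :=
    (ht₀.div_const (p t₀)).congr fun k => by field_simp
  have hfeq : f =ᵐ[volume.restrict (S : Set ℝ)] fun t : ℝ =>
      c₀ * Real.sin θ + c₀ * Real.cos θ * t + secondPrim f g t := by
    filter_upwards [hall] with t ht
    have := tendsto_nhds_unique ht (hclim.mul_const (p t))
    simp only [hp] at this
    linear_combination this
  obtain ⟨h1, h2, h3⟩ := isMax_secondPrim hfeq
  refine exists_mem_domain_of_rep (a := c₀ * Real.sin θ) (b := c₀ * Real.cos θ) h1 hfeq h2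
    ?_ ?_ (by ring)
  · have hcont : Continuous fun t : ℝ =>
        c₀ * Real.sin θ + c₀ * Real.cos θ * t + secondPrim f g t := by
      have : Continuous (secondPrim f g) :=
        continuous_iff_continuousAt.2 fun t => (hasDerivAt_secondPrim f g t).continuousAt
      fun_prop
    have := (hcont.tendsto 0).mono_left (nhdsWithin_le_nhds (s := (S : Set ℝ)))
    simpa [secondPrim] using this
  · rw [h3]
    have hcont : Continuous fun t : ℝ => c₀ * Real.cos θ + firstPrim f g t :=
      continuous_const.add (continuous_firstPrim f g)
    have := (hcont.tendsto 0).mono_left (nhdsWithin_le_nhds (s := (S : Set ℝ)))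
    simpa [firstPrim] using this

end Closed

/-! ### Gaussians times polynomials: derivatives, decay, integrability -/

section GaussianTimesPolynomial

open Polynomial

/-- The function `exp(-t²/2) q(t)`, for a real polynomial `q`. -/
def gaussPoly (q : ℝ[X]) (t : ℝ) : ℂ := ((Real.exp (-t ^ 2 / 2) * q.eval t : ℝ) : ℂ)

theorem gaussPoly_add (p q : ℝ[X]) (t : ℝ) :
    gaussPoly (p + q) t = gaussPoly p t + gaussPoly q t := by
  simp [gaussPoly, mul_add]

theorem gaussPoly_C_mul (c : ℝ) (q : ℝ[X]) (t : ℝ) :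
    gaussPoly (C c * q) t = c * gaussPoly q t := by
  simp [gaussPoly]
  ring

theorem gaussPoly_mul_left (p q : ℝ[X]) (t : ℝ) :
    gaussPoly (p * q) t = ((p.eval t : ℝ) : ℂ) * gaussPoly q t := by
  simp [gaussPoly]
  ring

theorem conj_gaussPoly (q : ℝ[X]) (t : ℝ) : (starRingEnd ℂ) (gaussPoly q t) = gaussPoly q t :=
  Complex.conj_ofReal _

theorem hasDerivAt_gaussPoly (q : ℝ[X]) (t : ℝ) :
    HasDerivAt (gaussPoly q) (gaussPoly (derivative q - X * q) t) t := by
  have h1 : HasDerivAt (fun s : ℝ => Real.exp (-s ^ 2 / 2)) (Real.exp (-t ^ 2 / 2) * (-t)) t := by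
    have : HasDerivAt (fun s : ℝ => -s ^ 2 / 2) (-t) t := by
      convert! ((hasDerivAt_pow 2 t).neg).div_const 2 using 1
      simp
      ring
    exact this.exp
  have h2 := (h1.mul (q.hasDerivAt t)).ofReal_comp
  convert! h2 using 1
  simp only [gaussPoly, eval_sub, eval_mul, eval_X, Complex.ofReal_inj]
  ring

theorem deriv_gaussPoly (q : ℝ[X]) :
    deriv (gaussPoly q) = gaussPoly (derivative q - X * q) :=
  funext fun t => (hasDerivAt_gaussPoly q t).deriv

theorem contDiff_gaussPoly (q : ℝ[X]) : ContDiff ℝ 1 (gaussPoly q) := by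
  rw [contDiff_one_iff_deriv]
  refine ⟨fun t => (hasDerivAt_gaussPoly q t).differentiableAt, ?_⟩
  rw [deriv_gaussPoly]
  exact continuous_iff_continuousAt.2 fun t => (hasDerivAt_gaussPoly _ t).continuousAt

theorem continuous_gaussPoly (q : ℝ[X]) : Continuous (gaussPoly q) :=
  (contDiff_gaussPoly q).continuous

theorem tendsto_gaussPoly (q : ℝ[X]) : Tendsto (gaussPoly q) (cocompact ℝ) (𝓝 0) := by
  induction q using Polynomial.induction_on' with
  | add p q hp hq =>
    have := hp.add hq
    rw [add_zero] at this
    exact this.congr fun t => (gaussPoly_add p q t).symm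
  | monomial n a =>
    have h := (tendsto_rpow_abs_mul_exp_neg_mul_sq_cocompact one_half_pos (n : ℝ)).const_mul |a|
    rw [mul_zero] at h
    rw [tendsto_zero_iff_norm_tendsto_zero]
    refine h.congr fun t => ?_
    simp only [gaussPoly, eval_monomial, Complex.norm_real, Real.norm_eq_abs, abs_mul, abs_pow,
      Real.abs_exp, Real.rpow_natCast]
    rw [show -(1 / 2) * t ^ 2 = -t ^ 2 / 2 by ring]
    ring

theorem integrable_exp_mul_eval {b : ℝ} (hb : 0 < b) (q : ℝ[X]) :
    Integrable fun t : ℝ => Real.exp (-b * t ^ 2) * q.eval t := by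
  induction q using Polynomial.induction_on' with
  | add p q hp hq =>
    refine (hp.add hq).congr (Eventually.of_forall fun t => ?_)
    simp only [Pi.add_apply, eval_add, mul_add]
  | monomial n a =>
    have h := (integrable_rpow_mul_exp_neg_mul_sq hb
      (show (-1 : ℝ) < (n : ℝ) by linarith [n.cast_nonneg (α := ℝ)])).const_mul a
    refine h.congr (Eventually.of_forall fun t => ?_)
    simp only [eval_monomial, Real.rpow_natCast]
    ring

theorem memLp_gaussPoly (q : ℝ[X]) : MemLp (gaussPoly q) 2 volume := by
  rw [memLp_two_iff_integrable_sq_norm (continuous_gaussPoly q).aestronglyMeasurable]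
  refine (integrable_exp_mul_eval one_pos (q ^ 2)).congr (Eventually.of_forall fun t => ?_)
  simp only [gaussPoly, Complex.norm_real, Real.norm_eq_abs, sq_abs, mul_pow, eval_pow]
  rw [← Real.exp_nat_mul]
  congr 2
  push_cast
  ring

end GaussianTimesPolynomial

/-! ### Hermite polynomials and Hermite functions -/

section HermitePolynomials

open Polynomial

/-- The Hermite polynomials, in the normalization with leading coefficient `2ⁿ`. -/
def hermitePoly : ℕ → ℝ[X]
  | 0 => 1
  | n + 1 => 2 * X * hermitePoly n - derivative (hermitePoly n)

/-- The lowering relation, from which the three-term recurrence, Hermite's equation and the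
nonvanishing of the polynomials all follow. -/
theorem derivative_hermitePoly_succ (n : ℕ) :
    derivative (hermitePoly (n + 1)) = 2 * ((n : ℝ[X]) + 1) * hermitePoly n := by
  induction n with
  | zero => simp [hermitePoly]
  | succ n ih =>
    have e : hermitePoly (n + 1) = 2 * X * hermitePoly n - derivative (hermitePoly n) := rfl
    have e' : derivative (derivative (hermitePoly (n + 1))) =
        2 * ((n : ℝ[X]) + 1) * derivative (hermitePoly n) := by
      rw [ih]
      simp [derivative_mul]
    rw [hermitePoly, derivative_sub, derivative_mul, e', ih, e]
    simp [derivative_mul]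
    ring

theorem X_mul_hermitePoly_zero : X * hermitePoly 0 = C (1 / 2) * hermitePoly 1 := by
  have : (C (1 / 2) * 2 : ℝ[X]) = 1 := by
    rw [← C_ofNat, ← C_mul]
    norm_num
  simp only [hermitePoly, derivative_one]
  linear_combination (-X : ℝ[X]) * this

theorem X_mul_hermitePoly_succ (n : ℕ) : X * hermitePoly (n + 1) =
    C (1 / 2) * hermitePoly (n + 2) + C ((n : ℝ) + 1) * hermitePoly n := by
  have : (C (1 / 2) * 2 : ℝ[X]) = 1 := by
    rw [← C_ofNat, ← C_mul]
    norm_num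
  have e : hermitePoly (n + 2) =
      2 * X * hermitePoly (n + 1) - derivative (hermitePoly (n + 1)) := rfl
  rw [e, derivative_hermitePoly_succ, C_add, C_1, C_eq_natCast]
  linear_combination (-X * hermitePoly (n + 1) + ((n : ℝ[X]) + 1) * hermitePoly n) * this

/-- Hermite's differential equation. -/
theorem hermitePoly_ode (n : ℕ) : derivative (derivative (hermitePoly n)) =
    2 * X * derivative (hermitePoly n) - 2 * (n : ℝ[X]) * hermitePoly n := by
  -- Differentiating the recursion for `hermitePoly (n + 1)` inside the lowering relation produces
  -- the second derivative.
  have h := derivative_hermitePoly_succ n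
  rw [hermitePoly, derivative_sub, derivative_mul] at h
  simp [derivative_mul] at h
  linear_combination -h

theorem hermitePoly_comp_neg (n : ℕ) :
    (hermitePoly n).comp (-X) = (-1) ^ n * hermitePoly n := by
  induction n with
  | zero => simp [hermitePoly]
  | succ n ih =>
    -- The recursion also contains the derivative of `hermitePoly n`, whose parity comes from
    -- differentiating the inductive hypothesis.
    have h := congrArg derivative ih
    rw [derivative_comp, derivative_mul] at h
    have hd : derivative ((-1 : ℝ[X]) ^ n) = 0 := by
      rw [← C_1, ← C_neg, ← C_pow, derivative_C]
    rw [hd] at h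
    simp only [derivative_neg, derivative_X] at h
    rw [hermitePoly, sub_comp, mul_comp, mul_comp, ih, X_comp, ofNat_comp]
    linear_combination h

theorem hermitePoly_eval_neg (n : ℕ) (t : ℝ) :
    (hermitePoly n).eval (-t) = (-1) ^ n * (hermitePoly n).eval t := by
  have := congrArg (eval t) (hermitePoly_comp_neg n)
  simpa [eval_comp] using this

theorem iteratedDeriv_exp_neg_sq (n : ℕ) : iteratedDeriv n (fun s : ℝ => Real.exp (-s ^ 2)) =
    fun t => (-1) ^ n * (hermitePoly n).eval t * Real.exp (-t ^ 2) := by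
  induction n with
  | zero => simp [hermitePoly]
  | succ n ih =>
    rw [iteratedDeriv_succ, ih]
    funext t
    have h1 : HasDerivAt (fun s : ℝ => Real.exp (-s ^ 2)) (Real.exp (-t ^ 2) * (-(2 * t))) t := by
      have : HasDerivAt (fun s : ℝ => -s ^ 2) (-(2 * t)) t := by
        convert! (hasDerivAt_pow 2 t).neg using 1
        simp
      exact this.exp
    have h2 := (((hermitePoly n).hasDerivAt t).const_mul ((-1) ^ n)).mul h1
    refine h2.deriv.trans ?_
    simp only [hermitePoly, eval_sub, eval_mul, eval_ofNat, eval_X]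
    ring

theorem hermiteH_eq (n : ℕ) (t : ℝ) : hermiteH n t = (hermitePoly n).eval t := by
  have h : Real.exp (t ^ 2) * Real.exp (-t ^ 2) = 1 := by rw [← Real.exp_add]; simp
  have h' : ((-1 : ℝ) ^ n) * (-1) ^ n = 1 := by rw [← mul_pow]; simp
  rw [hermiteH, iteratedDeriv_exp_neg_sq]
  linear_combination ((hermitePoly n).eval t * (-1) ^ n * (-1) ^ n) * h +
    (hermitePoly n).eval t * h'

/-- The normalizing factor of the Hermite functions. -/
def hermiteNorm (n : ℕ) : ℝ := (√(√Real.pi * 2 ^ n * (n.factorial : ℝ)))⁻¹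

theorem hermiteNorm_ne_zero (n : ℕ) : hermiteNorm n ≠ 0 := by
  have := Nat.cast_pos (α := ℝ).2 n.factorial_pos
  have := Real.pi_pos
  unfold hermiteNorm
  positivity

theorem hermiteFun_eq (n : ℕ) :
    hermiteFun n = gaussPoly (C (hermiteNorm n) * hermitePoly n) := by
  funext t
  simp only [hermiteFun, gaussPoly, hermiteH_eq, hermiteNorm, eval_mul, eval_C]
  ring_nf

theorem deriv_deriv_gaussPoly_hermitePoly (n : ℕ) (c t : ℝ) :
    deriv (deriv (gaussPoly (C c * hermitePoly n))) t =
      ((t : ℂ) ^ 2 - (2 * n + 1)) * gaussPoly (C c * hermitePoly n) t := by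
  have e : derivative (derivative (C c * hermitePoly n) - X * (C c * hermitePoly n)) -
      X * (derivative (C c * hermitePoly n) - X * (C c * hermitePoly n)) =
      (X ^ 2 - (2 * (n : ℝ[X]) + 1)) * (C c * hermitePoly n) := by
    have h := hermitePoly_ode n
    simp [derivative_mul]
    linear_combination (C c) * h
  rw [deriv_gaussPoly, deriv_gaussPoly, e, gaussPoly_mul_left]
  simp

theorem expr_hermiteFun (n : ℕ) (t : ℝ) :
    expr (hermiteFun n) t = ((n : ℂ) + 1 / 2) * hermiteFun n t := by
  rw [hermiteFun_eq, expr, deriv_deriv_gaussPoly_hermitePoly]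
  ring

theorem hermiteFun_zero_of_odd {n : ℕ} (hn : Odd n) : hermiteFun n 0 = 0 := by
  have h := hermitePoly_eval_neg n 0
  rw [hn.neg_one_pow, neg_zero] at h
  have h0 : (hermitePoly n).eval 0 = 0 := by linarith
  simp [hermiteFun_eq, gaussPoly, h0]

theorem deriv_hermiteFun_zero_of_even {n : ℕ} (hn : Even n) : deriv (hermiteFun n) 0 = 0 := by
  have h0 : (derivative (hermitePoly n)).eval 0 = 0 := by
    have h := congrArg (fun p => (derivative p).eval 0) (hermitePoly_comp_neg n)
    simp only [hn.neg_one_pow, one_mul, derivative_comp] at h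
    simp [eval_comp] at h
    linarith
  rw [hermiteFun_eq, deriv_gaussPoly]
  simp [gaussPoly, h0]

theorem isMax_hermiteFun (S : TopologicalSpace.Opens ℝ) (n : ℕ) : IsMax S (hermiteFun n) := by
  have hm : MemLp (hermiteFun n) 2 (volume.restrict (S : Set ℝ)) := by
    rw [hermiteFun_eq]
    exact (memLp_gaussPoly _).restrict _
  refine ⟨fun a b _ => ?_, fun t _ => ?_, fun a b _ => ?_, hm, ?_⟩
  · rw [hermiteFun_eq]
    exact (contDiff_gaussPoly _).contDiffOn.absolutelyContinuousOnInterval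
  · rw [hermiteFun_eq]
    exact (hasDerivAt_gaussPoly _ t).differentiableAt
  · rw [hermiteFun_eq, deriv_gaussPoly]
    exact (contDiff_gaussPoly _).contDiffOn.absolutelyContinuousOnInterval
  · rw [show expr (hermiteFun n) = ((n : ℂ) + 1 / 2) • hermiteFun n from
      funext (expr_hermiteFun n)]
    exact hm.const_smul _

/-- If one vanished, the lowering relation would make all earlier ones vanish, down to the constant
1. -/
theorem hermitePoly_ne_zero (n : ℕ) : hermitePoly n ≠ 0 := by
  intro h
  have : ∀ k, hermitePoly k = 0 → False := by
    intro k
    induction k with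
    | zero => simp [hermitePoly]
    | succ k ih =>
      intro hk
      have hd := derivative_hermitePoly_succ k
      rw [hk, derivative_zero, eq_comm, mul_eq_zero] at hd
      refine ih (hd.resolve_left ?_)
      have : (2 * ((k : ℝ[X]) + 1)) = ((2 * (k + 1) : ℕ) : ℝ[X]) := by push_cast; ring
      rw [this]
      exact Nat.cast_ne_zero.2 (by omega)
  exact this n h

end HermitePolynomials

/-! ### Completeness through moments and the Fourier transform -/

section Moments

open FourierTransform

/-- An integrable function with vanishing Fourier transform is zero almost everywhere. -/
theorem ae_eq_zero_of_fourier_eq_zero {F : ℝ → ℂ} (hF : Integrable F)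
    (h : ∀ ξ : ℝ, 𝓕 F ξ = 0) : ∀ᵐ t, F t = 0 := by
  refine ae_eq_zero_of_integral_contDiff_smul_eq_zero hF.locallyIntegrable fun φ hφ hc => ?_
  have hc' : HasCompactSupport (fun t => (φ t : ℂ)) := hc.comp_left Complex.ofReal_zero
  let Φ : SchwartzMap ℝ ℂ := hc'.toSchwartzMap (Complex.ofRealCLM.contDiff.comp hφ)
  have hΦ : 𝓕 (𝓕⁻ Φ) = Φ := FourierTransform.fourier_fourierInv_eq Φ
  -- The test function is the Fourier transform of `𝓕⁻ Φ`; the multiplication formula moves that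
  -- transform onto `F`, where it vanishes.
  have key := VectorFourier.integral_fourierIntegral_smul_eq_flip (L := innerₗ ℝ)
    (μ := volume) (ν := volume) Real.continuous_fourierChar continuous_inner
    hF (SchwartzMap.integrable (𝓕⁻ Φ) (μ := volume))
  have h1 : ∀ ξ, VectorFourier.fourierIntegral Real.fourierChar volume (innerₗ ℝ) F ξ = 0 := h
  have h2 : ∀ t, VectorFourier.fourierIntegral Real.fourierChar volume (innerₗ ℝ).flip
      (𝓕⁻ Φ : SchwartzMap ℝ ℂ) t = φ t := by
    intro t
    rw [flip_innerₗ]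
    exact DFunLike.congr_fun hΦ t
  simp only [h1, h2, zero_smul, integral_zero] at key
  rw [key]
  refine integral_congr_ae (Eventually.of_forall fun t => ?_)
  simp [mul_comm]

/-- Completing the square gives `2 c |t| - t² ≤ 2 c² - t² / 2`. -/
theorem memLp_exp_mul_abs_sub (c : ℝ) :
    MemLp (fun t : ℝ => Real.exp (c * |t| - t ^ 2 / 2)) 2 volume := by
  have hcont : Continuous fun t : ℝ => Real.exp (c * |t| - t ^ 2 / 2) := by fun_prop
  rw [memLp_two_iff_integrable_sq hcont.aestronglyMeasurable]
  refine ((integrable_exp_neg_mul_sq one_half_pos).const_mul (Real.exp (2 * c ^ 2))).mono'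
    (hcont.pow 2).aestronglyMeasurable (Eventually.of_forall fun t => ?_)
  rw [Real.norm_eq_abs, abs_of_nonneg (by positivity), ← Real.exp_nat_mul, ← Real.exp_add,
    Real.exp_le_exp]
  push_cast
  nlinarith [sq_nonneg (2 * c - |t|), sq_abs t]

/-- Dominated convergence for the exponential series: the norms of the terms sum to `exp ‖z‖ * ‖F‖`.
With `z` imaginary and linear, this expands a Fourier transform in moments. -/
theorem hasSum_integral_exp_mul {z F : ℝ → ℂ} (hz : Continuous z)
    (hF : AEStronglyMeasurable F volume) (hint : Integrable fun t => Real.exp ‖z t‖ * ‖F t‖) :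
    HasSum (fun n : ℕ => ∫ t, (z t ^ n / (n.factorial : ℂ)) * F t)
      (∫ t, Complex.exp (z t) * F t) := by
  refine hasSum_integral_of_dominated_convergence
    (fun n t => ‖z t‖ ^ n / (n.factorial : ℝ) * ‖F t‖)
    (fun n => (((hz.pow n).div_const _).aestronglyMeasurable).mul hF)
    (fun n => Eventually.of_forall fun t => ?_)
    (Eventually.of_forall fun t => (Real.summable_pow_div_factorial ‖z t‖).mul_right _)
    ?_ (Eventually.of_forall fun t => ?_)
  · rw [norm_mul, norm_div, norm_pow, Complex.norm_natCast]
  · refine hint.congr (Eventually.of_forall fun t => ?_)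
    simp only [tsum_mul_right]
    rw [Real.exp_eq_exp_ℝ, NormedSpace.exp_eq_tsum_div]
  · have h1 := NormedSpace.expSeries_div_hasSum_exp (𝔸 := ℂ) (z t)
    rw [← Complex.exp_eq_exp_ℂ] at h1
    exact h1.mul_right _

/-- Completeness of the functions `tⁿ exp(-t²/2)` in `L₂(ℝ)`. -/
theorem ae_eq_zero_of_moments {K : ℝ → ℂ} (hK : MemLp K 2 volume)
    (h : ∀ n : ℕ, ∫ t : ℝ, (t : ℂ) ^ n * ((Real.exp (-t ^ 2 / 2) : ℝ) * K t) = 0) :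
    ∀ᵐ t, K t = 0 := by
  set F : ℝ → ℂ := fun t => (Real.exp (-t ^ 2 / 2) : ℝ) * K t with hFdef
  have hbound : ∀ c : ℝ, Integrable fun t => Real.exp (c * |t|) * ‖F t‖ := by
    intro c
    refine ((memLp_exp_mul_abs_sub c).integrable_mul hK.norm).congr
      (Eventually.of_forall fun t => ?_)
    simp only [hFdef, Pi.mul_apply, norm_mul, Complex.norm_real, Real.norm_eq_abs, Real.abs_exp]
    rw [← mul_assoc, ← Real.exp_add]
    congr 2
    ring
  have hFm : AEStronglyMeasurable F volume := by
    refine AEStronglyMeasurable.mul ?_ hK.1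
    exact (by fun_prop : Continuous fun t : ℝ =>
      ((Real.exp (-t ^ 2 / 2) : ℝ) : ℂ)).aestronglyMeasurable
  have hFi : Integrable F := by
    rw [← integrable_norm_iff hFm]
    simpa using hbound 0
  have hzero : ∀ ξ : ℝ, 𝓕 F ξ = 0 := by
    intro ξ
    rw [Real.fourier_real_eq_integral_exp_smul]
    set z : ℝ → ℂ := fun t => ((-2 * Real.pi * t * ξ : ℝ) : ℂ) * Complex.I with hz
    have hzn : ∀ t, ‖z t‖ = (2 * Real.pi * |ξ|) * |t| := by
      intro t
      simp only [hz, norm_mul, Complex.norm_I, mul_one, Complex.norm_real, Real.norm_eq_abs,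
        abs_neg, abs_two, abs_of_pos Real.pi_pos]
      ring
    have hzc : Continuous z := by fun_prop
    have hs := hasSum_integral_exp_mul hzc hFm (by
      simp only [hzn]
      exact hbound _)
    have h0 : ∀ n : ℕ, ∫ t, (z t ^ n / (n.factorial : ℂ)) * F t = 0 := by
      intro n
      have : ∀ t : ℝ, (z t ^ n / (n.factorial : ℂ)) * F t =
          ((-2 * Real.pi * ξ * Complex.I) ^ n / (n.factorial : ℂ)) * ((t : ℂ) ^ n * F t) := by
        intro t
        simp only [hz]
        push_cast
        rw [show (-2 * (Real.pi : ℂ) * t * ξ * Complex.I) =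
          (-2 * Real.pi * ξ * Complex.I) * t by ring, mul_pow]
        ring
      simp_rw [this]
      rw [integral_const_mul, h n, mul_zero]
    simp only [h0] at hs
    have := hs.unique hasSum_zero
    simpa only [smul_eq_mul] using this
  filter_upwards [ae_eq_zero_of_fourier_eq_zero hFi hzero] with t ht
  simp only [hFdef, mul_eq_zero, Complex.ofReal_eq_zero] at ht
  exact ht.resolve_left (Real.exp_pos _).ne'

open Polynomial

/-- Completeness of the Hermite functions in `L₂(ℝ)`. -/
theorem ae_eq_zero_of_integral_hermitePoly {K : ℝ → ℂ} (hK : MemLp K 2 volume)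
    (h : ∀ n : ℕ, ∫ t, gaussPoly (hermitePoly n) t * K t = 0) : ∀ᵐ t, K t = 0 := by
  have hint : ∀ q, Integrable fun t => gaussPoly q t * K t := fun q =>
    (memLp_gaussPoly q).integrable_mul hK
  have hC : ∀ (c : ℝ) q, ∫ t, gaussPoly q t * K t = 0 → ∫ t, gaussPoly (C c * q) t * K t = 0 := by
    intro c q hq
    simp_rw [gaussPoly_C_mul, mul_assoc]
    rw [integral_const_mul, hq, mul_zero]
  -- The recurrence trades one factor `X` for neighbouring indices, so the induction on `k` must
  -- cover all `n`. Only `n = 0`, where the polynomial is 1, is used afterwards.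
  have hmul : ∀ k n : ℕ, ∫ t, gaussPoly (X ^ k * hermitePoly n) t * K t = 0 := by
    intro k
    induction k with
    | zero => simpa using h
    | succ k ih =>
      intro n
      cases n with
      | zero =>
        rw [pow_succ, mul_assoc, X_mul_hermitePoly_zero, mul_left_comm]
        exact hC _ _ (ih 1)
      | succ n =>
        rw [pow_succ, mul_assoc, X_mul_hermitePoly_succ, mul_add, mul_left_comm,
          mul_left_comm (X ^ k)]
        simp_rw [gaussPoly_add, add_mul]
        rw [integral_add (hint _) (hint _), hC _ _ (ih _), hC _ _ (ih _), add_zero]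
  refine ae_eq_zero_of_moments hK fun n => ?_
  rw [← hmul n 0]
  refine integral_congr_ae (Eventually.of_forall fun t => ?_)
  simp only [gaussPoly, hermitePoly, mul_one, eval_pow, eval_X]
  push_cast
  ring

theorem gaussPoly_hermitePoly_neg (n : ℕ) (t : ℝ) :
    gaussPoly (hermitePoly n) (-t) = (-1) ^ n * gaussPoly (hermitePoly n) t := by
  simp only [gaussPoly, hermitePoly_eval_neg, neg_sq]
  push_cast
  ring

/-- The Hermite functions of one parity are total in `L₂` of a half line. -/
theorem eq_zero_of_integral_hermiteFun {S : TopologicalSpace.Opens ℝ} (hS : ∀ t ∈ S, -t ∉ S)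
    {j : ℕ} (hj : j < 2) (g : L2 S)
    (h : ∀ n : ℕ, ∫ t in (S : Set ℝ), hermiteFun (2 * n + j) t * g t = 0) : g = 0 := by
  set G : ℝ → ℂ := (S : Set ℝ).indicator g with hG
  have hGm : MemLp G 2 volume := memLp_indicator g
  have hGn : MemLp (fun t => G (-t)) 2 volume :=
    hGm.comp_measurePreserving (Measure.measurePreserving_neg volume)
  set K : ℝ → ℂ := fun t => G t + (-1) ^ j * G (-t) with hK
  have hKm : MemLp K 2 volume := hGm.add (hGn.const_mul _)
  have hpar : ∀ m, ∫ t, gaussPoly (hermitePoly m) t * K t =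
      (1 + (-1) ^ (j + m)) * ∫ t, gaussPoly (hermitePoly m) t * G t := by
    intro m
    have h1 : Integrable fun t => gaussPoly (hermitePoly m) t * G t :=
      (memLp_gaussPoly _).integrable_mul hGm
    have h2 : Integrable fun t => gaussPoly (hermitePoly m) t * G (-t) :=
      (memLp_gaussPoly _).integrable_mul hGn
    have h3 : ∫ t, gaussPoly (hermitePoly m) t * G (-t) =
        (-1) ^ m * ∫ t, gaussPoly (hermitePoly m) t * G t := by
      rw [← integral_neg_eq_self, ← integral_const_mul]
      refine integral_congr_ae (Eventually.of_forall fun t => ?_)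
      simp only [neg_neg, gaussPoly_hermitePoly_neg]
      ring
    have h4 : (fun t => gaussPoly (hermitePoly m) t * K t) = fun t =>
        gaussPoly (hermitePoly m) t * G t +
          (-1) ^ j * (gaussPoly (hermitePoly m) t * G (-t)) := by
      funext t
      simp only [hK]
      ring
    rw [h4, integral_add h1 (h2.const_mul _), integral_const_mul, h3]
    ring
  have hzero : ∀ m, ∫ t, gaussPoly (hermitePoly m) t * K t = 0 := by
    intro m
    rw [hpar]
    rcases Nat.even_or_odd (j + m) with he | ho
    · obtain ⟨n, rfl⟩ : ∃ n, m = 2 * n + j :=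
        ⟨(m - j) / 2, by rw [Nat.even_iff] at he; omega⟩
      have h5 := h n
      have h6 : ∫ t, gaussPoly (hermitePoly (2 * n + j)) t * G t =
          ∫ t in (S : Set ℝ), gaussPoly (hermitePoly (2 * n + j)) t * g t := by
        rw [← integral_indicator S.isOpen.measurableSet]
        refine integral_congr_ae (Eventually.of_forall fun t => ?_)
        by_cases ht : t ∈ (S : Set ℝ) <;> simp [hG, ht]
      rw [hermiteFun_eq] at h5
      simp_rw [gaussPoly_C_mul, mul_assoc] at h5
      rw [integral_const_mul] at h5
      rw [h6, (mul_eq_zero.1 h5).resolve_left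
        (by exact_mod_cast hermiteNorm_ne_zero _), mul_zero]
    · rw [ho.neg_one_pow, add_neg_cancel, zero_mul]
  have hfin := ae_eq_zero_of_integral_hermitePoly hKm hzero
  refine (Lp.eq_zero_iff_ae_eq_zero).2 ?_
  rw [EventuallyEq, ae_restrict_iff' S.isOpen.measurableSet]
  filter_upwards [hfin] with t ht htS
  have hn : -t ∉ (S : Set ℝ) := hS t htS
  simpa [hK, hG, indicator_of_mem htS, indicator_of_notMem hn] using ht

end Moments

/-! ### Facts common to the two half lines -/

section HalfLine

variable {S : TopologicalSpace.Opens ℝ}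

theorem ordConnected_of_halfLine (hS : S = RPlus ∨ S = RMinus) : (S : Set ℝ).OrdConnected := by
  rcases hS with rfl | rfl
  · exact ordConnected_Ioi
  · exact ordConnected_Iio

theorem nhdsWithin_neBot_of_halfLine (hS : S = RPlus ∨ S = RMinus) :
    (𝓝[(S : Set ℝ)] (0 : ℝ)).NeBot := by
  rcases hS with rfl | rfl
  · exact inferInstanceAs (𝓝[>] (0 : ℝ)).NeBot
  · exact inferInstanceAs (𝓝[<] (0 : ℝ)).NeBot

theorem neg_notMem_of_halfLine (hS : S = RPlus ∨ S = RMinus) : ∀ t ∈ S, -t ∉ S := by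
  rcases hS with rfl | rfl
  · intro t (ht : 0 < t) (h : 0 < -t)
    linarith
  · intro t (ht : t < 0) (h : -t < 0)
    linarith

/-- A limit along `cocompact ℝ` covers both infinite ends, so one hypothesis serves both signs. -/
theorem integral_eq_zero_of_tendsto (hS : S = RPlus ∨ S = RMinus) {φ : ℝ → ℂ}
    (hφ : IntegrableOn φ (S : Set ℝ))
    (hlim : Tendsto (fun t => ∫ s in (0 : ℝ)..t, φ s) (cocompact ℝ) (𝓝 0)) :
    ∫ t in (S : Set ℝ), φ t = 0 := by
  rcases hS with rfl | rfl
  · exact tendsto_nhds_unique (intervalIntegral_tendsto_integral_Ioi 0 hφ tendsto_id)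
      (hlim.mono_left atTop_le_cocompact)
  · have h1 : IntegrableOn φ (Iic 0) := (integrableOn_Iic_iff_integrableOn_Iio (by simp)).2 hφ
    have h2 := intervalIntegral_tendsto_integral_Iic 0 h1 tendsto_id
    rw [integral_Iic_eq_integral_Iio] at h2
    refine tendsto_nhds_unique h2 ?_
    have h3 := (hlim.mono_left atBot_le_cocompact).neg
    rw [neg_zero] at h3
    exact h3.congr fun t => (intervalIntegral.integral_symm _ _).symm

end HalfLine

/-! ### Growth bounds and Green's identity -/

section Symmetry

open Polynomial

variable {S : TopologicalSpace.Opens ℝ}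

/-- The polynomial bound on `v` is absorbed into the polynomial factor of the Gaussian. The exponent
3 is large enough for both primitives below. -/
theorem tendsto_gaussPoly_mul (q : ℝ[X]) {v : ℝ → ℂ} {C₀ : ℝ}
    (hv : ∀ t, ‖v t‖ ≤ C₀ * (1 + t ^ 2) ^ 3) :
    Tendsto (fun t => gaussPoly q t * v t) (cocompact ℝ) (𝓝 0) := by
  have h := ((tendsto_gaussPoly ((1 + X ^ 2) ^ 3 * q)).norm).const_mul C₀
  rw [norm_zero, mul_zero] at h
  refine squeeze_zero_norm (fun t => ?_) h
  rw [gaussPoly_mul_left, norm_mul, norm_mul, Complex.norm_real, Real.norm_eq_abs]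
  simp only [eval_pow, eval_add, eval_one, eval_X]
  rw [abs_of_nonneg (by positivity)]
  calc ‖gaussPoly q t‖ * ‖v t‖ ≤ ‖gaussPoly q t‖ * (C₀ * (1 + t ^ 2) ^ 3) := by
        gcongr
        exact hv t
    _ = _ := by ring

theorem abs_le_one_add_sq (t : ℝ) : |t| ≤ 1 + t ^ 2 := by
  nlinarith [sq_nonneg (|t| - 1), sq_abs t, abs_nonneg t]

theorem sqrt_abs_mul_le (f g : L2 S) (t : ℝ) :
    √|t| * (t ^ 2 * ‖f‖ + 2 * ‖g‖) ≤ (‖f‖ + 2 * ‖g‖) * (1 + t ^ 2) ^ 2 := by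
  have h1 : √|t| ≤ 1 + t ^ 2 := by
    rw [Real.sqrt_le_left (by positivity)]
    nlinarith [abs_le_one_add_sq t, sq_nonneg t]
  have h2 : t ^ 2 * ‖f‖ + 2 * ‖g‖ ≤ (1 + t ^ 2) * (‖f‖ + 2 * ‖g‖) := by
    nlinarith [norm_nonneg f, norm_nonneg g, mul_nonneg (sq_nonneg t) (norm_nonneg g)]
  calc √|t| * (t ^ 2 * ‖f‖ + 2 * ‖g‖)
      ≤ (1 + t ^ 2) * ((1 + t ^ 2) * (‖f‖ + 2 * ‖g‖)) := by gcongr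
    _ = _ := by ring

theorem norm_add_firstPrim_le (f g : L2 S) (b : ℂ) (t : ℝ) :
    ‖b + firstPrim f g t‖ ≤ (‖b‖ + (‖f‖ + 2 * ‖g‖)) * (1 + t ^ 2) ^ 3 := by
  have h1 := (norm_firstPrim_le f g t).trans (sqrt_abs_mul_le f g t)
  have h2 : (1 + t ^ 2) ^ 2 ≤ (1 + t ^ 2) ^ 3 :=
    pow_le_pow_right₀ (by nlinarith [sq_nonneg t]) (by norm_num)
  have h3 : 1 ≤ (1 + t ^ 2) ^ 3 := one_le_pow₀ (by nlinarith [sq_nonneg t])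
  calc ‖b + firstPrim f g t‖ ≤ ‖b‖ * 1 + (‖f‖ + 2 * ‖g‖) * (1 + t ^ 2) ^ 2 := by
        rw [mul_one]
        exact (norm_add_le _ _).trans (by gcongr)
    _ ≤ ‖b‖ * (1 + t ^ 2) ^ 3 + (‖f‖ + 2 * ‖g‖) * (1 + t ^ 2) ^ 3 := by gcongr
    _ = _ := by ring

theorem norm_add_secondPrim_le (f g : L2 S) (a b : ℂ) (t : ℝ) :
    ‖a + b * t + secondPrim f g t‖ ≤ (‖a‖ + ‖b‖ + (‖f‖ + 2 * ‖g‖)) * (1 + t ^ 2) ^ 3 := by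
  have h0 := abs_le_one_add_sq t
  have h1 : ‖secondPrim f g t‖ ≤ (‖f‖ + 2 * ‖g‖) * (1 + t ^ 2) ^ 3 := by
    refine (norm_secondPrim_le f g t).trans ?_
    calc _ ≤ ((‖f‖ + 2 * ‖g‖) * (1 + t ^ 2) ^ 2) * (1 + t ^ 2) := by
          exact mul_le_mul (sqrt_abs_mul_le f g t) h0 (abs_nonneg t) (by positivity)
      _ = _ := by ring
  have h2 : 1 + t ^ 2 ≤ (1 + t ^ 2) ^ 3 :=
    le_self_pow₀ (by nlinarith [sq_nonneg t]) (by norm_num)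
  have h3 : 1 ≤ (1 + t ^ 2) ^ 3 := one_le_pow₀ (by nlinarith [sq_nonneg t])
  calc ‖a + b * t + secondPrim f g t‖
      ≤ ‖a‖ * 1 + ‖b‖ * |t| + (‖f‖ + 2 * ‖g‖) * (1 + t ^ 2) ^ 3 := by
        refine (norm_add₃_le).trans ?_
        rw [mul_one, norm_mul, Complex.norm_real, Real.norm_eq_abs]
        gcongr
    _ ≤ ‖a‖ * (1 + t ^ 2) ^ 3 + ‖b‖ * (1 + t ^ 2) ^ 3 + (‖f‖ + 2 * ‖g‖) * (1 + t ^ 2) ^ 3 := by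
        gcongr
        exact h0.trans h2
    _ = _ := by ring

/-- Green's identity on the half line against a Hermite function satisfying the same boundary
condition. -/
theorem integral_hermiteFun_mul_expr (hS : S = RPlus ∨ S = RMinus) {θ : ℝ} {n : ℕ}
    (hbc : (Real.cos θ : ℂ) * hermiteFun n 0 = Real.sin θ * deriv (hermiteFun n) 0)
    (x : (oscillator S θ).domain) :
    ∫ t in (S : Set ℝ), hermiteFun n t * oscillator S θ x t =
      ((n : ℂ) + 1 / 2) * ∫ t in (S : Set ℝ), hermiteFun n t * (x : L2 S) t := by
  have := nhdsWithin_neBot_of_halfLine hS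
  obtain ⟨u, hu, hxu, hTu, a, b, ha, hb, hab⟩ := exists_rep_of_mem_domain x
  set f : L2 S := (x : L2 S) with hf
  set g : L2 S := oscillator S θ x with hg
  set q : ℝ[X] := C (hermiteNorm n) * hermitePoly n with hq
  rw [hermiteFun_eq] at hbc ⊢
  -- A C¹ function on all of `ℝ` that agrees with `u` on `S`; this allows integration from 0 itself.
  set v : ℝ → ℂ := fun t => a + b * t + secondPrim f g t with hv
  set e : ℝ → ℂ := gaussPoly q with he
  set e' : ℝ → ℂ := gaussPoly (derivative q - X * q) with he'
  have hed : ∀ t, HasDerivAt e (e' t) t := hasDerivAt_gaussPoly q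
  have hed' : ∀ t : ℝ, HasDerivAt e' (((t : ℂ) ^ 2 - (2 * n + 1)) * e t) t := by
    intro t
    rw [he, hq, ← deriv_deriv_gaussPoly_hermitePoly, ← hq, deriv_gaussPoly]
    exact (hasDerivAt_gaussPoly _ t).differentiableAt.hasDerivAt
  have hvd : ∀ t, HasDerivAt v (b + firstPrim f g t) t := by
    intro t
    have h1 := (((Complex.ofRealCLM.hasDerivAt (x := t)).const_mul b).const_add a).add
      (hasDerivAt_secondPrim f g t)
    convert! h1 using 1
    simp
  have hvc : Continuous v := continuous_iff_continuousAt.2 fun t => (hvd t).continuousAt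
  have hec : Continuous e := continuous_gaussPoly q
  have hvd' : ∀ᵐ t, HasDerivAt (fun t => b + firstPrim f g t) (secondDeriv f g t) t := by
    filter_upwards [LocallyIntegrable.ae_hasDerivAt_integral
      (locallyIntegrable_secondDeriv f g)] with t ht
    exact (ht 0).const_add b
  -- The Wronskian of `e` and `v`, whose derivative is `φ` almost everywhere.
  set W : ℝ → ℂ := fun t => e t * (b + firstPrim f g t) - e' t * v t with hW
  set φ : ℝ → ℂ := fun t =>
    e t * secondDeriv f g t - (((t : ℂ) ^ 2 - (2 * n + 1)) * e t) * v t with hφ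
  have hWd : ∀ᵐ t, HasDerivAt W (φ t) t := by
    filter_upwards [hvd'] with t ht
    convert! ((hed t).mul ht).sub ((hed' t).mul (hvd t)) using 1
    simp only [hφ]
    ring
  have hvC1 : ContDiff ℝ 1 v := by
    rw [contDiff_one_iff_deriv]
    refine ⟨fun t => (hvd t).differentiableAt, ?_⟩
    rw [show deriv v = fun t => b + firstPrim f g t from funext fun t => (hvd t).deriv]
    exact continuous_const.add (continuous_firstPrim f g)
  have hWac : ∀ c d, AbsolutelyContinuousOnInterval W c d := by
    intro c d
    refine AbsolutelyContinuousOnInterval.sub ?_ ?_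
    · exact ((contDiff_gaussPoly q).contDiffOn.absolutelyContinuousOnInterval).smul
        (absolutelyContinuousOnInterval_const_add_firstPrim f g b c d)
    · exact ((contDiff_gaussPoly _).contDiffOn.absolutelyContinuousOnInterval).smul
        hvC1.contDiffOn.absolutelyContinuousOnInterval
  have hφi : ∀ c d, IntervalIntegrable φ volume c d := by
    intro c d
    refine ((intervalIntegrable_secondDeriv f g c d).continuousOn_mul hec.continuousOn).sub ?_
    exact (by fun_prop : Continuous fun t : ℝ =>
      (((t : ℂ) ^ 2 - (2 * n + 1)) * e t) * v t).intervalIntegrable c d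
  -- The boundary data of `e` and of `v` both lie on the line spanned by `(sin θ, cos θ)`, so their
  -- determinant vanishes.
  have hW0 : W 0 = 0 := by
    have htrig : (Real.sin θ : ℂ) ^ 2 + (Real.cos θ : ℂ) ^ 2 = 1 := by
      exact_mod_cast Real.sin_sq_add_cos_sq θ
    have hbc' : (Real.cos θ : ℂ) * e 0 = Real.sin θ * e' 0 := by
      rw [hbc, he, deriv_gaussPoly]
    have h1 : firstPrim f g 0 = 0 := by simp [firstPrim]
    have h2 : v 0 = a := by simp [hv, secondPrim]
    simp only [hW, h1, h2]
    linear_combination (-(e 0 * b - e' 0 * a)) * htrig +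
      (Real.cos θ * b + Real.sin θ * a) * hbc' - (Real.sin θ * e 0 + Real.cos θ * e' 0) * hab
  have hint : ∀ t, ∫ s in (0 : ℝ)..t, φ s = W t := by
    intro t
    rw [integral_eq_sub_of_ae_hasDerivAt (hWac 0 t) (hWd.mono fun _ h _ => h) (hφi 0 t), hW0,
      sub_zero]
  have hWlim : Tendsto W (cocompact ℝ) (𝓝 0) := by
    have h1 := tendsto_gaussPoly_mul q (norm_add_firstPrim_le f g b)
    have h2 := tendsto_gaussPoly_mul (derivative q - X * q) (norm_add_secondPrim_le f g a b)
    have := h1.sub h2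
    rwa [sub_zero] at this
  have hem : MemLp e 2 (volume.restrict (S : Set ℝ)) := (memLp_gaussPoly q).restrict _
  have hef : Integrable (fun t => e t * f t) (volume.restrict (S : Set ℝ)) :=
    hem.integrable_mul (Lp.memLp f)
  have heg : Integrable (fun t => e t * g t) (volume.restrict (S : Set ℝ)) :=
    hem.integrable_mul (Lp.memLp g)
  -- On `S` the potential terms `t² * e * f` cancel.
  have hφeq : φ =ᵐ[volume.restrict (S : Set ℝ)] fun t =>
      (2 * (n : ℂ) + 1) * (e t * f t) - 2 * (e t * g t) := by
    filter_upwards [hxu, ae_restrict_mem S.isOpen.measurableSet] with t h1 h2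
    have h3 := (hu.eq_secondPrim (ordConnected_of_halfLine hS) hxu hTu ha hb h2).2
    simp only [hφ, secondDeriv, indicator_of_mem h2]
    have h4 : v t = f t := by rw [h1, h3]
    rw [h4]
    ring
  have hzero := integral_eq_zero_of_tendsto hS (φ := φ)
    (((hef.const_mul (2 * (n : ℂ) + 1)).sub (heg.const_mul 2)).congr hφeq.symm)
    (hWlim.congr fun t => (hint t).symm)
  rw [integral_congr_ae hφeq, integral_sub (hef.const_mul _) (heg.const_mul _),
    integral_const_mul, integral_const_mul] at hzero
  linear_combination (-1 / 2) * hzero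

end Symmetry

/-! ### Assembly for the two parities -/

section Main

variable {S : TopologicalSpace.Opens ℝ}

theorem memLp_hermiteFun (S : TopologicalSpace.Opens ℝ) (n : ℕ) :
    MemLp (hermiteFun n) 2 (volume.restrict (S : Set ℝ)) :=
  (isMax_hermiteFun S n).memLp

theorem inner_hermiteFun (n : ℕ) (f : L2 S) :
    inner ℂ (memLp_hermiteFun S n).toLp f = ∫ t in (S : Set ℝ), hermiteFun n t * f t := by
  rw [L2.inner_def]
  refine integral_congr_ae ?_
  filter_upwards [(memLp_hermiteFun S n).coeFn_toLp] with t ht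
  rw [ht, RCLike.inner_apply, hermiteFun_eq, conj_gaussPoly, mul_comm]

/-- Vanishing almost everywhere would mean vanishing on the open set `S` by continuity, giving a
nonzero polynomial infinitely many roots. -/
theorem toLp_hermiteFun_ne_zero (hS : (S : Set ℝ).Nonempty) (n : ℕ) :
    (memLp_hermiteFun S n).toLp ≠ 0 := by
  intro h
  have h1 : hermiteFun n =ᵐ[volume.restrict (S : Set ℝ)] (0 : ℝ → ℂ) :=
    (memLp_hermiteFun S n).coeFn_toLp.symm.trans ((Lp.eq_zero_iff_ae_eq_zero).1 h)
  have h2 := (isMax_hermiteFun S n).eqOn isMax_zero h1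
  refine hermitePoly_ne_zero n (Polynomial.eq_zero_of_infinite_isRoot _ ?_)
  refine (infinite_of_mem_nhds hS.some
    (S.isOpen.mem_nhds hS.some_mem)).mono fun t ht => ?_
  have h3 := h2 ht
  rw [hermiteFun_eq, gaussPoly_C_mul] at h3
  have h4 : gaussPoly (hermitePoly n) t = 0 :=
    (mul_eq_zero.1 h3).resolve_left (by exact_mod_cast hermiteNorm_ne_zero n)
  rw [gaussPoly, Complex.ofReal_eq_zero] at h4
  exact (mul_eq_zero.1 h4).resolve_left (Real.exp_pos _).ne'

/-- The spectrum of `A_{±,θ}` when the Hermite functions of one parity satisfy the boundary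
condition. -/
theorem spectrum_oscillator (hS : S = RPlus ∨ S = RMinus) {θ : ℝ} {j : ℕ} (hj : j < 2)
    (hbc : ∀ n : ℕ, (Real.cos θ : ℂ) * hermiteFun (2 * n + j) 0 =
      Real.sin θ * deriv (hermiteFun (2 * n + j)) 0) :
    spectrum (oscillator S θ) = pointSpectrum (oscillator S θ) ∧
      pointSpectrum (oscillator S θ) = {z | ∃ n : ℕ, z = 2 * (n : ℂ) + (j + 1 / 2)} ∧
      ∀ n : ℕ, eigenspace (oscillator S θ) (2 * (n : ℂ) + (j + 1 / 2)) =
        Submodule.span ℂ {(memLp_hermiteFun S (2 * n + j)).toLp} := by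
  have := nhdsWithin_neBot_of_halfLine hS
  have hne : (S : Set ℝ).Nonempty :=
    nonempty_of_mem (self_mem_nhdsWithin : (S : Set ℝ) ∈ 𝓝[(S : Set ℝ)] (0 : ℝ))
  have hcast : ∀ n : ℕ, ((2 * (n : ℝ) + (j + 1 / 2) : ℝ) : ℂ) = 2 * (n : ℂ) + (j + 1 / 2) := by
    intro n
    push_cast
    ring
  have hcast' : ∀ n : ℕ, (((2 * n + j : ℕ) : ℂ) + 1 / 2) =
      ((2 * (n : ℝ) + (j + 1 / 2) : ℝ) : ℂ) := by
    intro n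
    push_cast
    ring
  have h := spectrum_of_total_eigenfamily (T := oscillator S θ)
    (e := fun n => (memLp_hermiteFun S (2 * n + j)).toLp)
    (μ := fun n : ℕ => 2 * (n : ℝ) + (j + 1 / 2))
    (fun m n hmn => by
      have : (m : ℝ) = n := by simpa using hmn
      exact_mod_cast this)
    (tendsto_atTop_add_const_right _ _
      (tendsto_natCast_atTop_atTop.const_mul_atTop two_pos))
    (fun n => toLp_hermiteFun_ne_zero hne _)
    (fun n => ?_) (fun n x => ?_) (fun y hy => ?_)
    (oscillator_closed (ordConnected_of_halfLine hS))
  · simpa only [hcast] using h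
  · have hm := isMax_hermiteFun S (2 * n + j)
    have hc : Continuous (hermiteFun (2 * n + j)) := by
      rw [hermiteFun_eq]
      exact continuous_gaussPoly _
    have hc' : Continuous (deriv (hermiteFun (2 * n + j))) := by
      rw [hermiteFun_eq, deriv_gaussPoly]
      exact continuous_gaussPoly _
    refine exists_mem_domain_of_rep hm hm.memLp.coeFn_toLp ?_
      ((hc.tendsto 0).mono_left nhdsWithin_le_nhds)
      ((hc'.tendsto 0).mono_left nhdsWithin_le_nhds) (hbc n)
    filter_upwards [Lp.coeFn_smul ((2 * (n : ℝ) + (j + 1 / 2) : ℝ) : ℂ) (hm.memLp.toLp),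
      hm.memLp.coeFn_toLp] with t h1 h2
    rw [h1, Pi.smul_apply, h2, expr_hermiteFun, hcast', smul_eq_mul]
  · rw [inner_hermiteFun, inner_hermiteFun, integral_hermiteFun_mul_expr hS (hbc n), hcast']
  · refine eq_zero_of_integral_hermiteFun (neg_notMem_of_halfLine hS) hj y fun n => ?_
    rw [← inner_hermiteFun]
    exact hy n

end Main
end HalfLineOscillator

end

theorem corollary2p3 (S : TopologicalSpace.Opens ℝ)
    (hS : S = HalfLineOscillator.RPlus ∨ S = HalfLineOscillator.RMinus) :
    (HalfLineOscillator.spectrum (HalfLineOscillator.oscillator S 0) =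
        HalfLineOscillator.pointSpectrum (HalfLineOscillator.oscillator S 0) ∧
      HalfLineOscillator.pointSpectrum (HalfLineOscillator.oscillator S 0) =
        {z : ℂ | ∃ n : ℕ, z = 2 * (n : ℂ) + 3 / 2} ∧
      ∀ n : ℕ, ∃ hψ : MemLp (HalfLineOscillator.hermiteFun (2 * n + 1)) 2
          (volume.restrict (S : Set ℝ)),
        HalfLineOscillator.eigenspace (HalfLineOscillator.oscillator S 0) (2 * (n : ℂ) + 3 / 2) =
          Submodule.span ℂ {hψ.toLp}) ∧
    (HalfLineOscillator.spectrum (HalfLineOscillator.oscillator S (Real.pi / 2)) =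
        HalfLineOscillator.pointSpectrum (HalfLineOscillator.oscillator S (Real.pi / 2)) ∧
      HalfLineOscillator.pointSpectrum (HalfLineOscillator.oscillator S (Real.pi / 2)) =
        {z : ℂ | ∃ n : ℕ, z = 2 * (n : ℂ) + 1 / 2} ∧
      ∀ n : ℕ, ∃ hψ : MemLp (HalfLineOscillator.hermiteFun (2 * n)) 2
          (volume.restrict (S : Set ℝ)),
        HalfLineOscillator.eigenspace (HalfLineOscillator.oscillator S (Real.pi / 2))
            (2 * (n : ℂ) + 1 / 2) =
          Submodule.span ℂ {hψ.toLp}) := by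
  constructor
  · obtain ⟨h1, h2, h3⟩ := HalfLineOscillator.spectrum_oscillator hS (θ := 0) (j := 1) one_lt_two
      fun n => by simp [HalfLineOscillator.hermiteFun_zero_of_odd (odd_two_mul_add_one n)]
    have e : ((1 : ℕ) : ℂ) + 1 / 2 = 3 / 2 := by norm_num
    rw [e] at h2
    simp only [e] at h3
    exact ⟨h1, h2, fun n => ⟨_, h3 n⟩⟩
  · obtain ⟨h1, h2, h3⟩ := HalfLineOscillator.spectrum_oscillator hS (θ := Real.pi / 2) (j := 0)
      two_pos fun n => by
        simp [HalfLineOscillator.deriv_hermiteFun_zero_of_even (even_two_mul n)]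
    have e : ((0 : ℕ) : ℂ) + 1 / 2 = 1 / 2 := by norm_num
    rw [e] at h2
    simp only [e] at h3
    exact ⟨h1, h2, fun n => ⟨_, h3 n⟩⟩
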